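/- Let $K$ be a field and let $\mathbf{Ch}_K$ be the category of (possibly unbounded) chain complexes of $K$-vector spaces, with differentials of degree $-1$. Let $\mathbf{C}$ be the category with four objects $M, M_+, M_-, M_h$ whose only non-identity morphisms are $$M \xleftarrow{\,i_+\,} M_+ \xrightarrow{\,j_+\,} M_h \xleftarrow{\,j_-\,} M_- \xrightarrow{\,i_-\,} M ,$$ let $\mathbf{B}\mathbb{Z}$ be the category with one object $\ast$ and endomorphism group $\mathbb{Z}$, and let $L:\mathbf{C}\to\mathbf{B}\mathbb{Z}$ be the functor with $L(i_-)=1$ and $L(i_+)=L(j_+)=L(j_-)=0$. Write $\mathsf{s}f,\mathsf{t}f$ for the source and target of a morphism $f$, let $L^*$ be the pullback along $L$ and let $L_!$ be the left Kan extension along $L$. On $\mathbf{Fun}(\mathbf{C},\mathbf{Ch}_K)$ and $\mathbf{Fun}(\mathbf{B}\mathbb{Z},\mathbf{Ch}_K)$ consider the projective model structures: weak equivalences are the componentwise quasi-isomorphisms, fibrations are the componentwise degreewise surjections, and cofibrations are the morphisms with the left lifting property against all fibrations that are weak equivalences. *Bar models.* For $X\in\mathbf{Fun}(\mathbf{C},\mathbf{Ch}_K)$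 and $N \in\mathbf{C}$ let $$Q(X)(N)_m=\bigoplus_{\mathsf{t}g=N}X(\mathsf{s}g)_m\ \oplus\bigoplus_{\mathsf{t}g=N,\ \mathsf{s}g=\mathsf{t}f,\ f\neq\mathrm{id}}X(\mathsf{s}f)_{m-1},\qquad \mathbb{L}L_!(X)_m=\bigoplus_{n\in\mathbb{Z},\,N\in\mathbf{C}}X(N)_m\ \oplus\bigoplus_{n\in\mathbb{Z},\,f\neq\mathrm{id}}X(\mathsf{s}f)_{m-1},$$ with elements written $(g,x),(g,f,x)$ and $(n,N,x),(n,f,x)$, respectively. The differentials are $$(g,x)\mapsto(g,\mathrm{d}x),\qquad (g,f,x)\mapsto(g,f,\mathrm{d}x)+(-1)^{|x|}\big((gf,x)-(g,X(f)x)\big),$$ $$(n,N,x)\mapsto(n,N,\mathrm{d}x),\qquad (n,f,x)\mapsto(n,f,\mathrm{d}x)+(-1)^{|x|}\big((n+L(f),\mathsf{s}f,x)-(n,\mathsf{t}f,X(f)x)\big).$$ A morphism $h$ of $\mathbf{C}$ acts on $Q(X)$ by $g\mapsto hg$, and $k\in\mathbb{Z}$ acts on $\mathbb{L}L_!(X)$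 by $n\mapsto n+k$. Consider the natural transformations $$q_X:Q(X)\to X,\quad (g,x)\mapsto X(g)x,\quad (g,f,x)\mapsto 0,$$ $$\epsilon_Y:\mathbb{L}L_!(L^*Y)\to Y,\quad (n,N,y)\mapsto Y(n)y,\quad (n,f,y)\mapsto 0,$$ $$\eta_X:Q(X)\to L^*\mathbb{L}L_!(X),\quad (g,x)\mapsto(L(g),\mathsf{s}g,x),\quad (g,f,x)\mapsto(L(g),f,x).$$ **Theorem.** The adjunction $L_!\dashv L^*$ is a Quillen adjunction ($L_!$ preserves cofibrations and $L^*$ preserves fibrations). Every $Q(X)$ is cofibrant and every $q_X$ is a weak equivalence. There is a natural isomorphism $\theta:\mathbb{L}L_!\cong L_!Q$ such that, for all $X$ and $Y$, the composite $L^*(\theta_X)\circ\eta_X$ is the adjunction unit $Q(X)\to L^*L_!Q(X)$, and $\epsilon_Y$ is the composite $$\mathbb{L}L_!(L^*Y)\xrightarrow{\ \theta_{L^*Y}\ }L_!Q(L^*Y)\xrightarrow{\ L_!(q_{L^*Y})\ }L_!L^*Y\longrightarrow Y$$ with the adjunction counit; thus $\mathbb{L}L_!$, $\eta$ and $\epsilon$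 are models of the left derived functor of $L_!$, of the derived unit and of the derived counit. Moreover: 1. the derived counit is a natural weak equivalence: $\epsilon_Y:\mathbb{L}L_!(L^*Y)\to Y$ is a weak equivalence for every $Y\in\mathbf{Fun}(\mathbf{B}\mathbb{Z},\mathbf{Ch}_K)$; 2. the derived unit is a natural weak equivalence on the functors that invert all morphisms up to homotopy: $\eta_X:Q(X)\to L^*\mathbb{L}L_!(X)$ is a weak equivalence for every $X\in\mathbf{Fun}(\mathbf{C},\mathbf{Ch}_K)$ that sends every morphism of $\mathbf{C}$ to a quasi-isomorphism. -/

import Mathlib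

open CategoryTheory CategoryTheory.Limits

universe v u

namespace RCE

/-! ### The category `C` and its localization functor `L : C ⥤ Bℤ` -/

/-- The objects of the category `C`: the spacetime `M`, the two spacetimes `M₊` and `M₋`, and the
perturbed spacetime `M_h`. -/
inductive Obj : Type
  | M
  | Mplus
  | Mminus
  | Mh

/-- The morphisms of `C`: the identities and the four arrows
`M ⟵ M₊ ⟶ M_h ⟵ M₋ ⟶ M`, called `i₊`, `j₊`, `j₋`, `i₋`. -/
inductive Mor : Obj → Obj → Type
  | id (N : Obj) : Mor N N
  | iPlus : Mor Obj.Mplus Obj.M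
  | jPlus : Mor Obj.Mplus Obj.Mh
  | iMinus : Mor Obj.Mminus Obj.M
  | jMinus : Mor Obj.Mminus Obj.Mh

/-- Composition in `C`; in every composable pair at least one of the morphisms is an identity. -/
def Mor.comp : {a b c : Obj} → Mor a b → Mor b c → Mor a c
  | _, _, _, Mor.id _, g => g
  | _, _, _, Mor.iPlus, Mor.id _ => Mor.iPlus
  | _, _, _, Mor.jPlus, Mor.id _ => Mor.jPlus
  | _, _, _, Mor.iMinus, Mor.id _ => Mor.iMinus
  | _, _, _, Mor.jMinus, Mor.id _ => Mor.jMinus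

instance : Category.{0} Obj where
  Hom := Mor
  id := Mor.id
  comp := Mor.comp
  id_comp f := rfl
  comp_id f := by cases f <;> rfl
  assoc f g h := by cases f <;> cases g <;> rfl

/-- The four non-identity morphisms of `C`. -/
inductive Arr : Type
  | iPlus
  | jPlus
  | iMinus
  | jMinus

/-- The source of a non-identity morphism. -/
def Arr.src : Arr → Obj
  | iPlus => Obj.Mplus
  | jPlus => Obj.Mplus
  | iMinus => Obj.Mminus
  | jMinus => Obj.Mminus

/-- The target of a non-identity morphism. -/
def Arr.tgt : Arr → Obj
  | iPlus => Obj.M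
  | jPlus => Obj.Mh
  | iMinus => Obj.M
  | jMinus => Obj.Mh

/-- An element of `Arr`, viewed as a morphism of `C`. -/
def Arr.hom : (f : Arr) → (f.src ⟶ f.tgt)
  | iPlus => Mor.iPlus
  | jPlus => Mor.jPlus
  | iMinus => Mor.iMinus
  | jMinus => Mor.jMinus

/-- The category `Bℤ` with one object and the group of integers as endomorphisms. -/
abbrev BZ : Type := SingleObj (Multiplicative ℤ)

/-- The integer that the localization functor assigns to a morphism of `C`:
`i₋ ↦ 1`, and `0` for all other morphisms. -/
def Mor.level : {a b : Obj} → Mor a b → ℤ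
  | _, _, Mor.iMinus => 1
  | _, _, _ => 0

/-- The localization functor `L : C ⥤ Bℤ`. -/
def L : Obj ⥤ BZ where
  obj _ := SingleObj.star _
  map f := Multiplicative.ofAdd (Mor.level f)
  map_id _ := rfl
  map_comp {a b c} (f : Mor a b) (g : Mor b c) := by cases f <;> cases g <;> rfl

/-! ### Chain complexes, direct sums and totalizations -/

/-- The category of (possibly unbounded) chain complexes of `K`-vector spaces;
differentials lower the degree by one. -/
abbrev Ch (K : Type u) [Field K] := ChainComplex (ModuleCat.{v} K) ℤ

variable {K : Type u} [Field K]

theorem d_d_apply (Z : Ch.{v} K) (m n p : ℤ) (x : Z.X m) :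
    (Z.d n p).hom ((Z.d m n).hom x) = 0 := by
  rw [← LinearMap.comp_apply, ← ModuleCat.hom_comp, Z.d_comp_d, ModuleCat.hom_zero,
    LinearMap.zero_apply]

theorem map_d_apply {Z T : Ch.{v} K} (t : Z ⟶ T) (m n : ℤ) (x : Z.X m) :
    (T.d m n).hom ((t.f m).hom x) = (t.f n).hom ((Z.d m n).hom x) := by
  rw [← LinearMap.comp_apply, ← ModuleCat.hom_comp, t.comm, ModuleCat.hom_comp,
    LinearMap.comp_apply]

section DirectSum

variable {ι : Type}

open Classical in
/-- The direct sum of a family of chain complexes. -/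
noncomputable def dirSum (Z : ι → Ch.{v} K) : Ch.{v} K where
  X m := ModuleCat.of K (DirectSum ι fun i => (Z i).X m)
  d m n := ModuleCat.ofHom (DirectSum.lmap fun i => ((Z i).d m n).hom)
  shape m n h := by
    refine ModuleCat.hom_ext (DirectSum.linearMap_ext K fun i => LinearMap.ext fun x => ?_)
    simp [(Z i).shape m n h]
  d_comp_d' m n p _ _ := by
    refine ModuleCat.hom_ext (DirectSum.linearMap_ext K fun i => LinearMap.ext fun x => ?_)
    change DirectSum.lmap _ (DirectSum.lmap _ (DirectSum.lof K ι (fun i => (Z i).X m) i x)) = 0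
    rw [DirectSum.lmap_lof, DirectSum.lmap_lof, d_d_apply, map_zero]

open Classical in
/-- The inclusion of a summand. -/
noncomputable def dirSum.incl (Z : ι → Ch.{v} K) (i : ι) : Z i ⟶ dirSum Z where
  f m := ModuleCat.ofHom (DirectSum.lof K ι (fun i => (Z i).X m) i)
  comm' m n _ := by
    refine ModuleCat.hom_ext (LinearMap.ext fun x => ?_)
    change DirectSum.lmap _ (DirectSum.lof K ι (fun i => (Z i).X m) i x) = _
    rw [DirectSum.lmap_lof]
    rfl

open Classical in
/-- The chain map out of a direct sum that is given by a family of chain maps. -/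
noncomputable def dirSum.desc {Z : ι → Ch.{v} K} {T : Ch.{v} K} (t : ∀ i, Z i ⟶ T) :
    dirSum Z ⟶ T where
  f m := ModuleCat.ofHom (DirectSum.toModule K ι _ fun i => ((t i).f m).hom)
  comm' m n _ := by
    refine ModuleCat.hom_ext (DirectSum.linearMap_ext K fun i => LinearMap.ext fun x => ?_)
    change (T.d m n).hom (DirectSum.toModule K ι (T.X m) (fun i => ((t i).f m).hom)
        (DirectSum.lof K ι (fun i => (Z i).X m) i x)) =
      DirectSum.toModule K ι (T.X n) (fun i => ((t i).f n).hom)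
        (DirectSum.lmap (fun i => ((Z i).d m n).hom) (DirectSum.lof K ι (fun i => (Z i).X m) i x))
    rw [DirectSum.lmap_lof, DirectSum.toModule_lof, DirectSum.toModule_lof, map_d_apply]

@[simp]
theorem dirSum.incl_desc {Z : ι → Ch.{v} K} {T : Ch.{v} K} (t : ∀ i, Z i ⟶ T) (i : ι) :
    dirSum.incl Z i ≫ dirSum.desc t = t i := by
  classical
  refine HomologicalComplex.Hom.ext (funext fun m => ?_)
  refine ModuleCat.hom_ext (LinearMap.ext fun x => ?_)
  change DirectSum.toModule K ι (T.X m) (fun i => ((t i).f m).hom)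
    (DirectSum.lof K ι (fun i => (Z i).X m) i x) = _
  rw [DirectSum.toModule_lof]

@[simp]
theorem dirSum.incl_desc_assoc {Z : ι → Ch.{v} K} {T S : Ch.{v} K} (t : ∀ i, Z i ⟶ T) (i : ι)
    (h : T ⟶ S) : dirSum.incl Z i ≫ dirSum.desc t ≫ h = t i ≫ h := by
  rw [← Category.assoc, dirSum.incl_desc]

theorem dirSum.hom_ext {Z : ι → Ch.{v} K} {T : Ch.{v} K} {f g : dirSum Z ⟶ T}
    (h : ∀ i, dirSum.incl Z i ≫ f = dirSum.incl Z i ≫ g) : f = g := by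
  classical
  refine HomologicalComplex.Hom.ext (funext fun m => ?_)
  refine ModuleCat.hom_ext (DirectSum.linearMap_ext K fun i => LinearMap.ext fun x => ?_)
  exact congr_arg (fun k : Z i ⟶ T => (k.f m).hom x) (h i)

end DirectSum

section Tot

/-- The differential `(b, a) ↦ (d b + (-1)^{|a|} φ a, d a)` of the totalization below. -/
noncomputable def totD {A B : Ch.{v} K} (φ : A ⟶ B) (m : ℤ) :
    (B.X m × A.X (m - 1)) →ₗ[K] (B.X (m - 1) × A.X (m - 1 - 1)) :=
  LinearMap.prod
    ((B.d m (m - 1)).hom ∘ₗ LinearMap.fst K _ _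
      + ((m - 1).negOnePow : ℤ) • ((φ.f (m - 1)).hom ∘ₗ LinearMap.snd K _ _))
    ((A.d (m - 1) (m - 1 - 1)).hom ∘ₗ LinearMap.snd K _ _)

theorem totD_apply {A B : Ch.{v} K} (φ : A ⟶ B) (m : ℤ) (b : B.X m) (a : A.X (m - 1)) :
    totD φ m (b, a) = ((B.d m (m - 1)).hom b + ((m - 1).negOnePow : ℤ) • (φ.f (m - 1)).hom a,
      (A.d (m - 1) (m - 1 - 1)).hom a) := rfl

theorem totD_totD {A B : Ch.{v} K} (φ : A ⟶ B) (m : ℤ) (x : B.X m × A.X (m - 1)) :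
    totD φ (m - 1) (totD φ m x) = 0 := by
  obtain ⟨b, a⟩ := x
  rw [totD_apply, totD_apply]
  have h : (((m - 1 - 1).negOnePow : ℤˣ) : ℤ) = -((m - 1).negOnePow : ℤ) := by
    rw [Int.negOnePow_sub (m - 1) 1]
    simp
  simp only [map_add, d_d_apply, map_zsmul, map_d_apply, h, neg_smul, zero_add, add_neg_cancel]
  rfl

/-- The `⊕`-totalization of the bicomplex that has the column `B` in vertical degree `0`, the column
`A` in vertical degree `1`, and the vertical differential `δ a = (-1)^{|a|} φ a`. In degree `m` it is
`B_m ⊕ A_{m-1}`, and its differential is the sum of the vertical and the horizontal one. -/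
noncomputable def tot {A B : Ch.{v} K} (φ : A ⟶ B) : Ch.{v} K where
  X m := ModuleCat.of K (B.X m × A.X (m - 1))
  d m n := if h : m - 1 = n then ModuleCat.ofHom (totD φ m) ≫ eqToHom (by subst h; rfl) else 0
  shape m n h := dif_neg fun h' => h (show n + 1 = m by omega)
  d_comp_d' m n p hmn hnp := by
    obtain rfl : m - 1 = n := by
      have : n + 1 = m := hmn
      omega
    obtain rfl : m - 1 - 1 = p := by
      have : p + 1 = m - 1 := hnp
      omega
    rw [dif_pos rfl, dif_pos rfl, eqToHom_refl, eqToHom_refl, Category.comp_id, Category.comp_id]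
    exact ModuleCat.hom_ext (LinearMap.ext fun x => totD_totD φ m x)

theorem tot_d {A B : Ch.{v} K} (φ : A ⟶ B) (m : ℤ) :
    (tot φ).d m (m - 1) = ModuleCat.ofHom (totD φ m) := by
  refine (dif_pos rfl).trans ?_
  exact Category.comp_id _

/-- Functoriality of the totalization. -/
noncomputable def tot.map {A B A' B' : Ch.{v} K} {φ : A ⟶ B} {φ' : A' ⟶ B'} (a : A ⟶ A')
    (b : B ⟶ B') (h : φ ≫ b = a ≫ φ') : tot φ ⟶ tot φ' where
  f m := ModuleCat.ofHom (LinearMap.prodMap (b.f m).hom (a.f (m - 1)).hom)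
  comm' m n hmn := by
    obtain rfl : m - 1 = n := by
      have : n + 1 = m := hmn
      omega
    rw [tot_d, tot_d]
    refine ModuleCat.hom_ext (LinearMap.ext fun x => ?_)
    obtain ⟨y, x⟩ := x
    have h' : (b.f (m - 1)).hom ((φ.f (m - 1)).hom x) = (φ'.f (m - 1)).hom ((a.f (m - 1)).hom x) :=
      congr_arg (fun k : A ⟶ B' => (k.f (m - 1)).hom x) h
    change totD φ' m ((b.f m).hom y, (a.f (m - 1)).hom x) =
      LinearMap.prodMap (b.f (m - 1)).hom (a.f (m - 1 - 1)).hom (totD φ m (y, x))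
    rw [totD_apply, totD_apply, LinearMap.prodMap_apply, map_add, map_zsmul, h', map_d_apply,
      map_d_apply]

/-- The chain map out of a totalization that is `b` on vertical degree `0` and `0` on vertical
degree `1`. -/
noncomputable def tot.desc {A B T : Ch.{v} K} {φ : A ⟶ B} (b : B ⟶ T) (h : φ ≫ b = 0) :
    tot φ ⟶ T where
  f m := ModuleCat.ofHom ((b.f m).hom ∘ₗ LinearMap.fst K (B.X m) (A.X (m - 1)))
  comm' m n hmn := by
    obtain rfl : m - 1 = n := by
      have : n + 1 = m := hmn
      omega
    rw [tot_d]
    refine ModuleCat.hom_ext (LinearMap.ext fun x => ?_)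
    obtain ⟨y, x⟩ := x
    have h' : (b.f (m - 1)).hom ((φ.f (m - 1)).hom x) = 0 :=
      congr_arg (fun k : A ⟶ T => (k.f (m - 1)).hom x) h
    change (T.d m (m - 1)).hom ((b.f m).hom y) = (b.f (m - 1)).hom (totD φ m (y, x)).1
    rw [totD_apply, map_add, map_zsmul, h', smul_zero, add_zero, map_d_apply]

theorem tot.map_id {A B : Ch.{v} K} (φ : A ⟶ B) (h : φ ≫ 𝟙 B = 𝟙 A ≫ φ) :
    tot.map (𝟙 A) (𝟙 B) h = 𝟙 (tot φ) := rfl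

theorem tot.map_comp {A B A' B' A'' B'' : Ch.{v} K} {φ : A ⟶ B} {φ' : A' ⟶ B'} {φ'' : A'' ⟶ B''}
    (a : A ⟶ A') (b : B ⟶ B') (h : φ ≫ b = a ≫ φ') (a' : A' ⟶ A'') (b' : B' ⟶ B'')
    (h' : φ' ≫ b' = a' ≫ φ'') (h'' : φ ≫ b ≫ b' = (a ≫ a') ≫ φ'') :
    tot.map a b h ≫ tot.map a' b' h' = tot.map (a ≫ a') (b ≫ b') h'' := rfl

theorem tot.map_desc {A B A' B' T : Ch.{v} K} {φ : A ⟶ B} {φ' : A' ⟶ B'} (a : A ⟶ A')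
    (b : B ⟶ B') (h : φ ≫ b = a ≫ φ') (t : B' ⟶ T) (ht : φ' ≫ t = 0) (h' : φ ≫ b ≫ t = 0) :
    tot.map a b h ≫ tot.desc t ht = tot.desc (b ≫ t) h' := rfl

theorem tot.desc_comp {A B T S : Ch.{v} K} {φ : A ⟶ B} (t : B ⟶ T) (ht : φ ≫ t = 0) (s : T ⟶ S)
    (h : φ ≫ t ≫ s = 0) : tot.desc t ht ≫ s = tot.desc (t ≫ s) h := rfl

end Tot

/-! ### The bar construction -/

section Bar

variable {D : Type} [SmallCategory D] (F : Obj ⥤ D)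

/-- The direct sum `⊕_{c ∈ C} ⊕_{g ∈ D(F c, d)} X(c)`: the part of vertical degree `0` of the bar
construction at `d`. -/
noncomputable def bar₀ (X : Obj ⥤ Ch.{v} K) (d : D) : Ch.{v} K :=
  dirSum fun i : (Σ c : Obj, F.obj c ⟶ d) => X.obj i.1

/-- The direct sum `⊕_{f ≠ id} ⊕_{g ∈ D(F (t f), d)} X(s f)`: the part of vertical degree `1` of the
bar construction at `d`. -/
noncomputable def bar₁ (X : Obj ⥤ Ch.{v} K) (d : D) : Ch.{v} K :=
  dirSum fun i : (Σ f : Arr, F.obj f.tgt ⟶ d) => X.obj i.1.src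

variable {F} {E : Type} [SmallCategory E] {G : Obj ⥤ E} {B : Type} [SmallCategory B] {H : Obj ⥤ B}
variable {X X' X'' : Obj ⥤ Ch.{v} K} {d : D} {e : E} {b : B} {T S : Ch.{v} K}

variable (X) in
/-- The inclusion `x ↦ (c, g, x)` of a summand in vertical degree `0`. -/
noncomputable def incl₀ {c : Obj} (g : F.obj c ⟶ d) : X.obj c ⟶ bar₀ F X d :=
  dirSum.incl (fun i : (Σ c : Obj, F.obj c ⟶ d) => X.obj i.1) ⟨c, g⟩

variable (X) in
/-- The inclusion `x ↦ (t f, g, f, x)` of a summand in vertical degree `1`. -/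
noncomputable def incl₁ (f : Arr) (g : F.obj f.tgt ⟶ d) : X.obj f.src ⟶ bar₁ F X d :=
  dirSum.incl (fun i : (Σ f : Arr, F.obj f.tgt ⟶ d) => X.obj i.1.src) ⟨f, g⟩

/-- The chain map `(c, g, x) ↦ t c g x`. -/
noncomputable def desc₀ (t : ∀ c, (F.obj c ⟶ d) → (X.obj c ⟶ T)) : bar₀ F X d ⟶ T :=
  dirSum.desc fun i => t i.1 i.2

/-- The chain map `(t f, g, f, x) ↦ t f g x`. -/
noncomputable def desc₁ (t : ∀ f : Arr, (F.obj f.tgt ⟶ d) → (X.obj f.src ⟶ T)) : bar₁ F X d ⟶ T :=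
  dirSum.desc fun i => t i.1 i.2

theorem incl_desc₀ (t : ∀ c, (F.obj c ⟶ d) → (X.obj c ⟶ T)) {c : Obj} (g : F.obj c ⟶ d) :
    incl₀ X g ≫ desc₀ t = t c g := dirSum.incl_desc _ _

theorem incl_desc₁ (t : ∀ f : Arr, (F.obj f.tgt ⟶ d) → (X.obj f.src ⟶ T)) (f : Arr)
    (g : F.obj f.tgt ⟶ d) : incl₁ X f g ≫ desc₁ t = t f g := dirSum.incl_desc _ _

theorem incl_desc₀_assoc (t : ∀ c, (F.obj c ⟶ d) → (X.obj c ⟶ T)) {c : Obj} (g : F.obj c ⟶ d)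
    (h : T ⟶ S) : incl₀ X g ≫ desc₀ t ≫ h = t c g ≫ h := dirSum.incl_desc_assoc _ _ _

theorem incl_desc₁_assoc (t : ∀ f : Arr, (F.obj f.tgt ⟶ d) → (X.obj f.src ⟶ T)) (f : Arr)
    (g : F.obj f.tgt ⟶ d) (h : T ⟶ S) : incl₁ X f g ≫ desc₁ t ≫ h = t f g ≫ h :=
  dirSum.incl_desc_assoc _ _ _

theorem hom_ext₀ {s t : bar₀ F X d ⟶ T}
    (h : ∀ (c : Obj) (g : F.obj c ⟶ d), incl₀ X g ≫ s = incl₀ X g ≫ t) : s = t :=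
  dirSum.hom_ext fun i => h i.1 i.2

theorem hom_ext₁ {s t : bar₁ F X d ⟶ T}
    (h : ∀ (f : Arr) (g : F.obj f.tgt ⟶ d), incl₁ X f g ≫ s = incl₁ X f g ≫ t) : s = t :=
  dirSum.hom_ext fun i => h i.1 i.2

variable (F X d) in
/-- The vertical differential without its sign `(-1)^{|x|}`, which is part of `tot`:
`(t f, g, f, x) ↦ (s f, g ∘ F f, x) - (t f, g, X(f) x)`. -/
noncomputable def barδ : bar₁ F X d ⟶ bar₀ F X d :=
  desc₁ fun f g => incl₀ X (F.map f.hom ≫ g) - X.map f.hom ≫ incl₀ X g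

variable (F X d) in
/-- The totalized bar construction at `d`. As `C` has no composable pairs of non-identity morphisms,
the bar construction is concentrated in vertical degrees `0` and `1`. -/
noncomputable def barObj : Ch.{v} K := tot (barδ F X d)

theorem barδ_comm (r : ∀ c, (F.obj c ⟶ d) → (G.obj c ⟶ e))
    (hr : ∀ (f : Arr) (g : F.obj f.tgt ⟶ d), r _ (F.map f.hom ≫ g) = G.map f.hom ≫ r _ g)
    (ζ : X ⟶ X') :
    barδ F X d ≫ desc₀ (fun c g => ζ.app c ≫ incl₀ X' (r c g)) =
      desc₁ (fun f g => ζ.app f.src ≫ incl₁ X' f (r f.tgt g)) ≫ barδ G X' e := by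
  refine hom_ext₁ fun f g => ?_
  rw [barδ, barδ, incl_desc₁_assoc, incl_desc₁_assoc, Category.assoc, incl_desc₁,
    Preadditive.sub_comp, Preadditive.comp_sub, Category.assoc, incl_desc₀, incl_desc₀,
    hr, ζ.naturality_assoc]

theorem barδ_desc (t : ∀ c, (F.obj c ⟶ d) → (X.obj c ⟶ T))
    (ht : ∀ (f : Arr) (g : F.obj f.tgt ⟶ d), t _ (F.map f.hom ≫ g) = X.map f.hom ≫ t _ g) :
    barδ F X d ≫ desc₀ t = 0 := by
  refine hom_ext₁ fun f g => ?_
  rw [barδ, incl_desc₁_assoc, Preadditive.sub_comp, Category.assoc, incl_desc₀, incl_desc₀, ht,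
    sub_self, comp_zero]

/-- The chain map `(c, g, x) ↦ (c, r g, ζ x)`, `(c, g, f, x) ↦ (c, r g, f, ζ x)` between bar
constructions. -/
noncomputable def barHom (r : ∀ c, (F.obj c ⟶ d) → (G.obj c ⟶ e))
    (hr : ∀ (f : Arr) (g : F.obj f.tgt ⟶ d), r _ (F.map f.hom ≫ g) = G.map f.hom ≫ r _ g)
    (ζ : X ⟶ X') : barObj F X d ⟶ barObj G X' e :=
  tot.map (desc₁ fun f g => ζ.app f.src ≫ incl₁ X' f (r f.tgt g))
    (desc₀ fun c g => ζ.app c ≫ incl₀ X' (r c g)) (barδ_comm r hr ζ)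

theorem barHom_congr {r r' : ∀ c, (F.obj c ⟶ d) → (G.obj c ⟶ e)}
    {hr : ∀ (f : Arr) (g : F.obj f.tgt ⟶ d), r _ (F.map f.hom ≫ g) = G.map f.hom ≫ r _ g}
    {hr' : ∀ (f : Arr) (g : F.obj f.tgt ⟶ d), r' _ (F.map f.hom ≫ g) = G.map f.hom ≫ r' _ g}
    {ζ ζ' : X ⟶ X'} (h : ∀ c g, r c g = r' c g) (hζ : ζ = ζ') : barHom r hr ζ = barHom r' hr' ζ' := by
  obtain rfl : r = r' := funext fun c => funext fun g => h c g
  subst hζ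
  rfl

theorem barHom_id : barHom (fun _ g => g) (fun _ _ => rfl) (𝟙 X) = 𝟙 (barObj F X d) := by
  have h₀ : desc₀ (F := F) (d := d) (fun c g => (𝟙 X : X ⟶ X).app c ≫ incl₀ X g) = 𝟙 _ :=
    hom_ext₀ fun c g => by rw [incl_desc₀]; simp
  have h₁ : desc₁ (F := F) (d := d) (fun f g => (𝟙 X : X ⟶ X).app f.src ≫ incl₁ X f g) = 𝟙 _ :=
    hom_ext₁ fun f g => by rw [incl_desc₁]; simp
  simp only [barHom, h₀, h₁]
  rfl

theorem barHom_comp (r : ∀ c, (F.obj c ⟶ d) → (G.obj c ⟶ e))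
    (hr : ∀ (f : Arr) (g : F.obj f.tgt ⟶ d), r _ (F.map f.hom ≫ g) = G.map f.hom ≫ r _ g)
    (ζ : X ⟶ X') (r' : ∀ c, (G.obj c ⟶ e) → (H.obj c ⟶ b))
    (hr' : ∀ (f : Arr) (g : G.obj f.tgt ⟶ e), r' _ (G.map f.hom ≫ g) = H.map f.hom ≫ r' _ g)
    (ζ' : X' ⟶ X'') :
    barHom r hr ζ ≫ barHom r' hr' ζ' =
      barHom (fun c g => r' c (r c g)) (fun f g => by rw [hr, hr']) (ζ ≫ ζ') := by
  have h₀ : desc₀ (fun c g => ζ.app c ≫ incl₀ X' (r c g)) ≫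
      desc₀ (fun c g => ζ'.app c ≫ incl₀ X'' (r' c g)) =
      desc₀ fun c g => (ζ ≫ ζ').app c ≫ incl₀ X'' (r' c (r c g)) :=
    hom_ext₀ fun c g => by
      rw [incl_desc₀_assoc, incl_desc₀, Category.assoc, incl_desc₀, NatTrans.comp_app, Category.assoc]
  have h₁ : desc₁ (fun f g => ζ.app f.src ≫ incl₁ X' f (r f.tgt g)) ≫
      desc₁ (fun f g => ζ'.app f.src ≫ incl₁ X'' f (r' f.tgt g)) =
      desc₁ fun f g => (ζ ≫ ζ').app f.src ≫ incl₁ X'' f (r' f.tgt (r f.tgt g)) :=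
    hom_ext₁ fun f g => by
      rw [incl_desc₁_assoc, incl_desc₁, Category.assoc, incl_desc₁, NatTrans.comp_app, Category.assoc]
  simp only [barHom, ← h₀, ← h₁]
  rfl

/-- The chain map `(c, g, x) ↦ t c g x`, `(c, g, f, x) ↦ 0` out of the bar construction. -/
noncomputable def barDesc (t : ∀ c, (F.obj c ⟶ d) → (X.obj c ⟶ T))
    (ht : ∀ (f : Arr) (g : F.obj f.tgt ⟶ d), t _ (F.map f.hom ≫ g) = X.map f.hom ≫ t _ g) :
    barObj F X d ⟶ T :=
  tot.desc (desc₀ t) (barδ_desc t ht)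

theorem barDesc_congr {t t' : ∀ c, (F.obj c ⟶ d) → (X.obj c ⟶ T)}
    {ht : ∀ (f : Arr) (g : F.obj f.tgt ⟶ d), t _ (F.map f.hom ≫ g) = X.map f.hom ≫ t _ g}
    {ht' : ∀ (f : Arr) (g : F.obj f.tgt ⟶ d), t' _ (F.map f.hom ≫ g) = X.map f.hom ≫ t' _ g}
    (h : ∀ c g, t c g = t' c g) : barDesc t ht = barDesc t' ht' := by
  obtain rfl : t = t' := funext fun c => funext fun g => h c g
  rfl

theorem barHom_barDesc (r : ∀ c, (F.obj c ⟶ d) → (G.obj c ⟶ e))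
    (hr : ∀ (f : Arr) (g : F.obj f.tgt ⟶ d), r _ (F.map f.hom ≫ g) = G.map f.hom ≫ r _ g)
    (ζ : X ⟶ X') (t : ∀ c, (G.obj c ⟶ e) → (X'.obj c ⟶ T))
    (ht : ∀ (f : Arr) (g : G.obj f.tgt ⟶ e), t _ (G.map f.hom ≫ g) = X'.map f.hom ≫ t _ g) :
    barHom r hr ζ ≫ barDesc t ht =
      barDesc (fun c g => ζ.app c ≫ t c (r c g))
        (fun f g => by rw [hr, ht, ζ.naturality_assoc]) := by
  have h₀ : desc₀ (fun c g => ζ.app c ≫ incl₀ X' (r c g)) ≫ desc₀ t =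
      desc₀ fun c g => ζ.app c ≫ t c (r c g) :=
    hom_ext₀ fun c g => by rw [incl_desc₀_assoc, incl_desc₀, Category.assoc, incl_desc₀]
  simp only [barDesc, ← h₀]
  rfl

theorem barDesc_comp (t : ∀ c, (F.obj c ⟶ d) → (X.obj c ⟶ T))
    (ht : ∀ (f : Arr) (g : F.obj f.tgt ⟶ d), t _ (F.map f.hom ≫ g) = X.map f.hom ≫ t _ g)
    (s : T ⟶ S) :
    barDesc t ht ≫ s = barDesc (fun c g => t c g ≫ s) (fun f g => by rw [ht, Category.assoc]) := by
  have h₀ : desc₀ t ≫ s = desc₀ fun c g => t c g ≫ s :=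
    hom_ext₀ fun c g => by rw [incl_desc₀_assoc, incl_desc₀]
  simp only [barDesc, ← h₀]
  rfl

variable (F X) in
/-- The action `(c, g, x) ↦ (c, k ∘ g, x)`, `(c, g, f, x) ↦ (c, k ∘ g, f, x)` of a morphism `k` of `D`
on the bar construction. -/
noncomputable def barMap {d d' : D} (k : d ⟶ d') : barObj F X d ⟶ barObj F X d' :=
  barHom (fun _ g => g ≫ k) (fun _ _ => Category.assoc _ _ _) (𝟙 X)

variable (F d) in
/-- The chain map `(c, g, x) ↦ (c, g, ζ x)`, `(c, g, f, x) ↦ (c, g, f, ζ x)`. -/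
noncomputable def barNat (ζ : X ⟶ X') : barObj F X d ⟶ barObj F X' d :=
  barHom (fun _ g => g) (fun _ _ => rfl) ζ

variable (F X) in
/-- The chain map `(c, g, x) ↦ (c, F g, x)`, `(c, g, f, x) ↦ (c, F g, f, x)`. -/
noncomputable def barPush (N : Obj) : barObj (𝟭 Obj) X N ⟶ barObj F X (F.obj N) :=
  barHom (F := 𝟭 Obj) (d := N) (fun _ g => F.map g) (fun _ _ => F.map_comp _ _) (𝟙 X)

variable (F) in
/-- The chain map `(c, g, y) ↦ Y(g) y`, `(c, g, f, y) ↦ 0`. -/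
noncomputable def barEval (Y : D ⥤ Ch.{v} K) (d : D) : barObj F (F ⋙ Y) d ⟶ Y.obj d :=
  barDesc (X := F ⋙ Y) (fun _ g => Y.map g) (fun _ _ => Y.map_comp _ _)

theorem barMap_id (d : D) : barMap F X (𝟙 d) = 𝟙 _ :=
  (barHom_congr (fun _ _ => Category.comp_id _) rfl).trans barHom_id

theorem barMap_comp {d d' d'' : D} (k : d ⟶ d') (l : d' ⟶ d'') :
    barMap F X (k ≫ l) = barMap F X k ≫ barMap F X l := by
  unfold barMap
  rw [barHom_comp]
  exact barHom_congr (fun c g => (Category.assoc g k l).symm) (Category.comp_id (𝟙 X)).symm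

theorem barNat_comp (ζ : X ⟶ X') (ξ : X' ⟶ X'') :
    barNat F d (ζ ≫ ξ) = barNat F d ζ ≫ barNat F d ξ := by
  unfold barNat
  rw [barHom_comp]

theorem barMap_barNat {d d' : D} (k : d ⟶ d') (ζ : X ⟶ X') :
    barMap F X k ≫ barNat F d' ζ = barNat F d ζ ≫ barMap F X' k := by
  unfold barMap barNat
  rw [barHom_comp, barHom_comp]
  exact barHom_congr (fun _ _ => rfl) ((Category.id_comp ζ).trans (Category.comp_id ζ).symm)

theorem barMap_barPush {N N' : Obj} (h : N ⟶ N') :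
    barMap (𝟭 Obj) X h ≫ barPush F X N' = barPush F X N ≫ barMap F X (F.map h) := by
  unfold barMap barPush
  rw [barHom_comp, barHom_comp]
  exact barHom_congr (fun _ g => F.map_comp g h) rfl

theorem barNat_barPush (N : Obj) (ζ : X ⟶ X') :
    barNat (𝟭 Obj) N ζ ≫ barPush F X' N = barPush F X N ≫ barNat F (F.obj N) ζ := by
  unfold barNat barPush
  rw [barHom_comp, barHom_comp]
  exact barHom_congr (fun _ _ => rfl) ((Category.comp_id ζ).trans (Category.id_comp ζ).symm)

theorem barMap_barEval (Y : D ⥤ Ch.{v} K) {d d' : D} (k : d ⟶ d') :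
    barMap F (F ⋙ Y) k ≫ barEval F Y d' = barEval F Y d ≫ Y.map k := by
  unfold barMap barEval
  rw [barHom_barDesc, barDesc_comp]
  exact barDesc_congr fun c g => (Category.id_comp _).trans (Y.map_comp g k)

theorem barNat_barEval {Y Y' : D ⥤ Ch.{v} K} (ζ : Y ⟶ Y') (d : D) :
    barNat F d (F.whiskerLeft ζ) ≫ barEval F Y' d = barEval F Y d ≫ ζ.app d := by
  unfold barNat barEval
  rw [barHom_barDesc, barDesc_comp]
  exact barDesc_congr fun c g => (ζ.naturality g).symm

variable (F) in
/-- The functor `X ↦ Tot^⊕ B(D, C, X)` associated with `F : C ⥤ D`. -/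
noncomputable def bar : (Obj ⥤ Ch.{v} K) ⥤ (D ⥤ Ch.{v} K) where
  obj X :=
    { obj := fun d => barObj F X d
      map := fun k => barMap F X k
      map_id := fun d => barMap_id d
      map_comp := fun k l => barMap_comp k l }
  map ζ :=
    { app := fun d => barNat F d ζ
      naturality := fun _ _ k => barMap_barNat k ζ }
  map_id _ := NatTrans.ext (funext fun _ => barHom_id)
  map_comp ζ ξ := NatTrans.ext (funext fun _ => barNat_comp ζ ξ)

variable (K) in
/-- The pullback functor along `F`. -/
abbrev pullback (F : Obj ⥤ D) : (D ⥤ Ch.{v} K) ⥤ (Obj ⥤ Ch.{v} K) :=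
  (Functor.whiskeringLeft Obj D (Ch.{v} K)).obj F

variable (K F) in
/-- The natural transformation from the bar construction of `F^* Y` to `Y`. -/
noncomputable def barCounit : pullback.{v} K F ⋙ bar F ⟶ 𝟭 (D ⥤ Ch.{v} K) where
  app Y :=
    { app := fun d => barEval F Y d
      naturality := fun _ _ k => barMap_barEval Y k }
  naturality _ _ ζ := NatTrans.ext (funext fun d => barNat_barEval ζ d)

variable (K F) in
/-- The natural transformation from the bar construction of the identity functor to the pullback of
the bar construction of `F`. -/
noncomputable def barUnit : bar.{v} (K := K) (𝟭 Obj) ⟶ bar F ⋙ pullback K F where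
  app X :=
    { app := fun N => barPush F X N
      naturality := fun _ _ h => barMap_barPush h }
  naturality _ _ ζ := NatTrans.ext (funext fun N => barNat_barPush N ζ)

end Bar

variable (K)

/-- The resolution `Q(X) = Tot^⊕ B(C, C, X)`, spanned by `(g, x)` with `x ∈ X(s g)` and `(g, f, x)` with
`x ∈ X(s f)`, `f ≠ id`. -/
noncomputable def Q : (Obj ⥤ Ch.{v} K) ⥤ (Obj ⥤ Ch.{v} K) := bar (𝟭 Obj)

/-- The functor `𝕃L_!(X) = Tot^⊕ B(Bℤ, C, X)`, spanned by `(n, N, x)` with `x ∈ X(N)` and `(n, f, x)`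
with `x ∈ X(s f)`, `f ≠ id`; here `n` is an endomorphism of the object of `Bℤ`. -/
noncomputable def LL : (Obj ⥤ Ch.{v} K) ⥤ (BZ ⥤ Ch.{v} K) := bar L

/-- The augmentation `q : Q(X) ⟶ X`, `(g, x) ↦ X(g) x`, `(g, f, x) ↦ 0`. -/
noncomputable def q : Q.{v} K ⟶ 𝟭 (Obj ⥤ Ch.{v} K) := barCounit K (𝟭 Obj)

/-- The bar model `ε : 𝕃L_!(L^* Y) ⟶ Y`, `(n, N, y) ↦ Y(n) y`, `(n, f, y) ↦ 0`, of the derived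
counit. -/
noncomputable def ε : pullback K L ⋙ LL.{v} K ⟶ 𝟭 (BZ ⥤ Ch.{v} K) := barCounit K L

/-- The bar model `η : Q(X) ⟶ L^* 𝕃L_!(X)`, `(g, x) ↦ (L(g), s g, x)`, `(g, f, x) ↦ (L(g), f, x)`, of
the derived unit. -/
noncomputable def η : Q.{v} K ⟶ LL.{v} K ⋙ pullback K L := barUnit K L

/-! ### The projective model structures -/

section Model

variable (J : Type) [SmallCategory J]

/-- The weak equivalences of `Fun(J, Ch_K)`: all components are quasi-isomorphisms. -/
def weakEq : MorphismProperty (J ⥤ Ch.{v} K) :=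
  fun _ _ ζ => ∀ j, QuasiIso (ζ.app j)

/-- The fibrations of `Fun(J, Ch_K)`: all components are degree-wise surjective. -/
def fib : MorphismProperty (J ⥤ Ch.{v} K) :=
  fun _ _ ζ => ∀ (j : J) (m : ℤ), Function.Surjective ((ζ.app j).f m).hom

/-- The cofibrations of `Fun(J, Ch_K)`: the morphisms with the left lifting property against all
fibrations that are also weak equivalences. -/
def cof : MorphismProperty (J ⥤ Ch.{v} K) := (weakEq K J ⊓ fib K J).llp

variable {K J} in
/-- The cofibrant objects of `Fun(J, Ch_K)`. -/
def IsCofibrantObj (X : J ⥤ Ch.{v} K) : Prop := cof K J (initial.to X)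

variable {K J} in
/-- An adjunction `F ⊣ G` between functor categories with the projective model structures is a Quillen
adjunction: `F` preserves cofibrations and `G` preserves fibrations. -/
def IsQuillenAdjunction {J' : Type} [SmallCategory J'] {F : (J ⥤ Ch.{v} K) ⥤ (J' ⥤ Ch.{v} K)}
    {G : (J' ⥤ Ch.{v} K) ⥤ (J ⥤ Ch.{v} K)} (_ : F ⊣ G) : Prop :=
  (∀ ⦃X X' : J ⥤ Ch.{v} K⦄ (ζ : X ⟶ X'), cof K J ζ → cof K J' (F.map ζ)) ∧
  (∀ ⦃Y Y' : J' ⥤ Ch.{v} K⦄ (ζ : Y ⟶ Y'), fib K J' ζ → fib K J (G.map ζ))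

end Model

variable {K} in
/-- The functors that send every morphism of `C` to a quasi-isomorphism. -/
def HoAll (X : Obj ⥤ Ch.{v} K) : Prop := ∀ ⦃N N' : Obj⦄ (f : N ⟶ N'), QuasiIso (X.map f)

/-- The left Kan extension functor `L_!` along `L`. -/
noncomputable abbrev Lan : (Obj ⥤ Ch.{v} K) ⥤ (BZ ⥤ Ch.{v} K) := L.lan

/-- The adjunction `L_! ⊣ L^*`. -/
noncomputable abbrev adj : Lan.{v} K ⊣ pullback.{v} K L := L.lanAdjunction (Ch.{v} K)

end RCE

namespace RCE

variable {K : Type u} [Field K]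

/-! ### Complexes of vector spaces -/

/-! No two non-identity morphisms of `C` are composable. Hence every bar construction has only two
columns, and a morphism out of it amounts to chain maps on the values of X together with one
homotopy per arrow that fills the naturality square, with no higher coherence (`BarData`). Over a
field a surjective quasi-isomorphism is a strong deformation retraction, so such data lift along
trivial fibrations and bar constructions are cofibrant. A morphism from Q(X) to a pullback F^*Y and
a morphism from the bar construction of F to Y consist of literally the same data. So `barUnit` is a
universal arrow, which identifies the bar construction with the left adjoint of F^* applied to Q(X),
and the formulas for unit and counit follow from universality.

The augmentations are quasi-isomorphisms because in each degree the columns form a short exact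
sequence 0 → `bar₁` → `bar₀` → Y(d) → 0 (`tot.quasiIso_desc`). For Q an extra degeneracy splits this
sequence. For ε the vertices (n, N) and the edges (n, f) form a line, and the sequence is its
augmented chain complex with coefficients in the local system Y. Cutting the line at an edge reads
off the coefficient of that edge, which gives injectivity; connectedness of the line gives exactness
in the middle.

For the unit, the triangle L^*ε ∘ η = q settles the case X = L^*Y by two-out-of-three. The bar
constructions preserve weak equivalences, so the property of η being a weak equivalence is invariant
under zigzags of them. If X inverts all morphisms, then X ← Q(X) → H(X) ≅ L^*Y is such a zigzag. The
middle map exists because over a field every complex maps to its homology naturally up to homotopy,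
and Y is H(X(M)) with the monodromy of H(X) around the loop of four arrows. -/

theorem exists_comp_eq_of_ker_le {V W U : Type*} [AddCommGroup V] [Module K V] [AddCommGroup W]
    [Module K W] [AddCommGroup U] [Module K U] (d : V →ₗ[K] W) (t : V →ₗ[K] U)
    (h : ∀ x, d x = 0 → t x = 0) : ∃ k : W →ₗ[K] U, ∀ x, k (d x) = t x := by
  obtain ⟨s, hs⟩ := d.rangeRestrict.exists_rightInverse_of_surjective d.range_rangeRestrict
  obtain ⟨k, hk⟩ := LinearMap.exists_extend (t ∘ₗ s)
  refine ⟨k, fun x => ?_⟩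
  have h₁ : k (d x) = t (s (d.rangeRestrict x)) := LinearMap.congr_fun hk (d.rangeRestrict x)
  have h₂ : d (s (d.rangeRestrict x)) = d x :=
    congr_arg Subtype.val (LinearMap.congr_fun hs (d.rangeRestrict x))
  rw [h₁, ← sub_eq_zero, ← map_sub]
  exact h _ (by rw [map_sub, h₂, sub_self])

theorem comp_apply' {Z T S : Ch.{v} K} (s : Z ⟶ T) (t : T ⟶ S) (m : ℤ) (x : Z.X m) :
    ((s ≫ t).f m).hom x = (t.f m).hom ((s.f m).hom x) := rfl

theorem hom_ext_apply {Z T : Ch.{v} K} {s t : Z ⟶ T}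
    (h : ∀ m x, (s.f m).hom x = (t.f m).hom x) : s = t :=
  HomologicalComplex.Hom.ext (funext fun m => ModuleCat.hom_ext (LinearMap.ext fun x => h m x))

/-! ### Homology classes and quasi-isomorphisms on elements -/

section Homology

variable (Z : Ch.{v} K) (m : ℤ)

theorem iCycles_injective : Function.Injective (Z.iCycles m).hom :=
  (ModuleCat.mono_iff_injective _).1 inferInstance

theorem homologyπ_surjective : Function.Surjective (Z.homologyπ m).hom :=
  (ModuleCat.epi_iff_surjective _).1 inferInstance

variable {Z m}

theorem d_iCycles_apply (n : ℤ) (z : Z.cycles m) :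
    (Z.d m n).hom ((Z.iCycles m).hom z) = 0 := by
  rw [← LinearMap.comp_apply, ← ModuleCat.hom_comp, Z.iCycles_d, ModuleCat.hom_zero,
    LinearMap.zero_apply]

theorem exists_cycle {n : ℤ} (hn : m - 1 = n) {x : Z.X m} (hx : (Z.d m n).hom x = 0) :
    ∃ z, (Z.iCycles m).hom z = x := by
  let k : ModuleCat.of K (LinearMap.ker (Z.d m n).hom) ⟶ Z.X m := ModuleCat.ofHom (Submodule.subtype _)
  have hk : k ≫ Z.d m n = 0 := ModuleCat.hom_ext (LinearMap.ext fun y => y.2)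
  refine ⟨(Z.liftCycles k n ((ChainComplex.next ℤ m).trans hn) hk).hom ⟨x, hx⟩, ?_⟩
  rw [← LinearMap.comp_apply, ← ModuleCat.hom_comp, Z.liftCycles_i]
  rfl

theorem homologyπ_eq_zero_iff {n : ℤ} (hn : n - 1 = m) (z : Z.cycles m) :
    (Z.homologyπ m).hom z = 0 ↔ ∃ y, (Z.d n m).hom y = (Z.iCycles m).hom z := by
  have hn' : (ComplexShape.down ℤ).prev m = n := by rw [ChainComplex.prev]; omega
  constructor
  · intro h
    obtain ⟨y, hy⟩ := (ShortComplex.moduleCat_exact_iff _).1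
      (ShortComplex.exact_of_g_is_cokernel (ShortComplex.mk _ _ (Z.toCycles_comp_homologyπ n m))
        (Z.homologyIsCokernel n m hn')) z h
    refine ⟨y, ?_⟩
    rw [← hy, ← Z.toCycles_i n m]
    rfl
  · rintro ⟨y, hy⟩
    have : (Z.toCycles n m).hom y = z := iCycles_injective Z m (by
      rw [← hy, ← LinearMap.comp_apply, ← ModuleCat.hom_comp, Z.toCycles_i])
    rw [← this, ← LinearMap.comp_apply, ← ModuleCat.hom_comp, Z.toCycles_comp_homologyπ,
      ModuleCat.hom_zero, LinearMap.zero_apply]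

variable {T : Ch.{v} K}

theorem homologyMap_homologyπ_apply (s : Z ⟶ T) (z : Z.cycles m) :
    (HomologicalComplex.homologyMap s m).hom ((Z.homologyπ m).hom z) =
      (T.homologyπ m).hom ((HomologicalComplex.cyclesMap s m).hom z) := by
  rw [← LinearMap.comp_apply, ← ModuleCat.hom_comp, HomologicalComplex.homologyπ_naturality]
  rfl

theorem iCycles_cyclesMap_apply (s : Z ⟶ T) (z : Z.cycles m) :
    (T.iCycles m).hom ((HomologicalComplex.cyclesMap s m).hom z) =
      (s.f m).hom ((Z.iCycles m).hom z) := by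
  rw [← LinearMap.comp_apply, ← ModuleCat.hom_comp, HomologicalComplex.cyclesMap_i]
  rfl

/-- A chain map is a quasi-isomorphism if and only if its mapping cone is acyclic, spelled out on
elements. -/
theorem quasiIso_iff_forall (s : Z ⟶ T) :
    QuasiIso s ↔ ∀ (m : ℤ) (x : Z.X (m - 1 - 1)) (y : T.X (m - 1)),
      (Z.d (m - 1 - 1) (m - 1 - 1 - 1)).hom x = 0 →
      (s.f (m - 1 - 1)).hom x = (T.d (m - 1) (m - 1 - 1)).hom y →
      ∃ (x' : Z.X (m - 1)) (y' : T.X m), (Z.d (m - 1) (m - 1 - 1)).hom x' = x ∧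
        (s.f (m - 1)).hom x' = y + (T.d m (m - 1)).hom y' := by
  have key : QuasiIso s ↔ ∀ m, Function.Bijective (HomologicalComplex.homologyMap s m).hom := by
    rw [quasiIso_iff]
    refine forall_congr' fun m => ?_
    rw [quasiIsoAt_iff_isIso_homologyMap]
    exact ConcreteCategory.isIso_iff_bijective (HomologicalComplex.homologyMap s m)
  rw [key]
  constructor
  -- Injectivity on homology makes x a boundary of some x₁. Then y minus the image of x₁ is a cycle,
  -- and surjectivity supplies a cycle a of Z that corrects x₁.
  · intro h m x y hx hxy
    obtain ⟨z, rfl⟩ := exists_cycle rfl hx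
    have h₁ : (Z.homologyπ _).hom z = 0 := (h _).1 (by
      rw [map_zero, homologyMap_homologyπ_apply, homologyπ_eq_zero_iff rfl]
      exact ⟨y, by rw [iCycles_cyclesMap_apply, hxy]⟩)
    obtain ⟨x₁, hx₁⟩ := (homologyπ_eq_zero_iff rfl z).1 h₁
    obtain ⟨w, hw⟩ : ∃ w, (T.iCycles _).hom w = y - (s.f _).hom x₁ :=
      exists_cycle rfl (by rw [map_sub, map_d_apply, hx₁, hxy, sub_self])
    obtain ⟨c, hc⟩ := (h _).2 ((T.homologyπ _).hom w)
    obtain ⟨a, rfl⟩ := homologyπ_surjective Z _ c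
    rw [homologyMap_homologyπ_apply, ← sub_eq_zero, ← map_sub, homologyπ_eq_zero_iff rfl] at hc
    obtain ⟨y', hy'⟩ := hc
    rw [map_sub, iCycles_cyclesMap_apply, hw] at hy'
    refine ⟨x₁ + (Z.iCycles _).hom a, y', ?_, ?_⟩
    · rw [map_add, d_iCycles_apply, hx₁, add_zero]
    · rw [map_add, hy']
      abel
  -- Injectivity uses the cone condition for a cycle whose image bounds y. Surjectivity is the case
  -- x = 0, with y the cycle to be hit.
  · intro h m
    constructor
    · rw [injective_iff_map_eq_zero]
      intro c hc
      obtain ⟨z, rfl⟩ := homologyπ_surjective Z _ c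
      obtain ⟨m, rfl⟩ : ∃ n, m = n - 1 - 1 := ⟨m + 1 + 1, by ring⟩
      rw [homologyMap_homologyπ_apply, homologyπ_eq_zero_iff rfl] at hc
      obtain ⟨y, hy⟩ := hc
      obtain ⟨x', -, hx', -⟩ := h m _ y (d_iCycles_apply _ z)
        (by rw [hy, iCycles_cyclesMap_apply])
      exact (homologyπ_eq_zero_iff rfl z).2 ⟨x', hx'⟩
    · intro c
      obtain ⟨w, rfl⟩ := homologyπ_surjective T _ c
      obtain ⟨m, rfl⟩ : ∃ n, m = n - 1 := ⟨m + 1, by ring⟩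
      obtain ⟨x', y', hx', hy'⟩ := h m 0 ((T.iCycles _).hom w) (map_zero _)
        (by rw [map_zero, d_iCycles_apply])
      obtain ⟨z, rfl⟩ := exists_cycle rfl hx'
      refine ⟨(Z.homologyπ _).hom z, ?_⟩
      rw [homologyMap_homologyπ_apply, ← sub_eq_zero, ← map_sub, homologyπ_eq_zero_iff rfl]
      exact ⟨y', by rw [map_sub, iCycles_cyclesMap_apply, hy', add_sub_cancel_left]⟩

end Homology

/-! ### Formality -/

section Formality

/-- The homology of a complex, as a complex with zero differential. -/
noncomputable def homologyComplex : Ch.{v} K ⥤ Ch.{v} K where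
  obj Z := { X := fun m => Z.homology m, d := fun _ _ => 0 }
  map s := { f := fun m => HomologicalComplex.homologyMap s m }
  map_id Z := HomologicalComplex.Hom.ext (funext fun m => HomologicalComplex.homologyMap_id Z m)
  map_comp s t := HomologicalComplex.Hom.ext
    (funext fun m => HomologicalComplex.homologyMap_comp s t m)

instance {Z T : Ch.{v} K} (s : Z ⟶ T) [QuasiIso s] : IsIso (homologyComplex.map s) := by
  have (m : ℤ) : IsIso ((homologyComplex.map s).f m) :=
    inferInstanceAs (IsIso (HomologicalComplex.homologyMap s m))
  exact HomologicalComplex.Hom.isIso_of_components _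

/-- Over a field the projection from cycles to homology extends to all chains. The extension is a
chain map because boundaries have class zero and the target has zero differential. -/
theorem exists_toHomology (Z : Ch.{v} K) :
    ∃ t : Z ⟶ homologyComplex.obj Z, ∀ m z, (t.f m).hom ((Z.iCycles m).hom z) =
      (Z.homologyπ m).hom z := by
  have h (m : ℤ) := exists_comp_eq_of_ker_le (Z.iCycles m).hom (Z.homologyπ m).hom
    fun x hx => by rw [iCycles_injective Z m (hx.trans (map_zero _).symm), map_zero]
  choose k hk using h
  refine ⟨{ f := fun m => ModuleCat.ofHom (k m), comm' := fun m n hmn => ?_ }, hk⟩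
  refine ModuleCat.hom_ext (LinearMap.ext fun x => ?_)
  have hmn : m - 1 = n := by
    have : n + 1 = m := hmn
    omega
  change 0 = k n ((Z.d m n).hom x)
  obtain ⟨z, hz⟩ := exists_cycle rfl (d_d_apply Z m n (n - 1) x)
  rw [← hz, hk, eq_comm, homologyπ_eq_zero_iff hmn]
  exact ⟨x, hz.symm⟩

/-- A chain map from a complex to its homology that sends every cycle to its class. -/
noncomputable def toHomology (Z : Ch.{v} K) : Z ⟶ homologyComplex.obj Z :=
  (exists_toHomology Z).choose

theorem toHomology_iCycles {Z : Ch.{v} K} {m : ℤ} (z : Z.cycles m) :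
    ((toHomology Z).f m).hom ((Z.iCycles m).hom z) = (Z.homologyπ m).hom z :=
  (exists_toHomology Z).choose_spec m z

instance (Z : Ch.{v} K) : QuasiIso (toHomology Z) := by
  rw [quasiIso_iff_forall]
  intro m x y hx hxy
  obtain ⟨z, rfl⟩ := exists_cycle rfl hx
  rw [toHomology_iCycles] at hxy
  obtain ⟨x₁, hx₁⟩ := (homologyπ_eq_zero_iff rfl z).1 hxy
  obtain ⟨w, hw⟩ := homologyπ_surjective Z (m - 1) (y - ((toHomology Z).f (m - 1)).hom x₁)
  refine ⟨x₁ + (Z.iCycles _).hom w, 0, ?_, ?_⟩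
  · rw [map_add, d_iCycles_apply, add_zero, hx₁]
  · rw [map_add, toHomology_iCycles, hw, map_zero, add_zero]
    abel

/-- Off the cycles `toHomology` depends on a choice of extension, so the square commutes strictly on
cycles only. This is exactly what makes it commute up to homotopy later. -/
theorem homologyMap_toHomology {Z T : Ch.{v} K} (s : Z ⟶ T) {m : ℤ} {x : Z.X m}
    (hx : (Z.d m (m - 1)).hom x = 0) :
    ((homologyComplex.map s).f m).hom (((toHomology Z).f m).hom x) =
      ((toHomology T).f m).hom ((s.f m).hom x) := by
  obtain ⟨z, rfl⟩ := exists_cycle rfl hx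
  rw [toHomology_iCycles, ← iCycles_cyclesMap_apply, toHomology_iCycles]
  exact homologyMap_homologyπ_apply s z

end Formality

/-! ### Surjective quasi-isomorphisms -/

section SurjectiveQuasiIso

variable {Z T : Ch.{v} K} {p : Z ⟶ T}

/-- The kernel of p is acyclic: the cone criterion gives a primitive of x whose image is a boundary,
and subtracting the boundary of a lift moves that primitive into the kernel. -/
theorem exists_d_eq_of_quasiIso_of_surjective (hp : QuasiIso p)
    (hp' : ∀ m, Function.Surjective (p.f m).hom) (m : ℤ) (x : Z.X (m - 1))
    (hx : (Z.d (m - 1) (m - 1 - 1)).hom x = 0) (hpx : (p.f (m - 1)).hom x = 0) :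
    ∃ x' : Z.X m, (Z.d m (m - 1)).hom x' = x ∧ (p.f m).hom x' = 0 := by
  obtain ⟨m, rfl⟩ : ∃ n, m = n - 1 := ⟨m + 1, by ring⟩
  obtain ⟨x', y', h₁, h₂⟩ := (quasiIso_iff_forall p).1 hp m x 0 hx (by rw [hpx, map_zero])
  obtain ⟨w, rfl⟩ := hp' _ y'
  refine ⟨x' - (Z.d m (m - 1)).hom w, ?_, ?_⟩
  · rw [map_sub, h₁, d_d_apply, sub_zero]
  · rw [map_sub, h₂, map_d_apply, zero_add, sub_self]

/-- An acyclic complex of vector spaces is contractible, applied to the kernel of p. -/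
theorem exists_contraction_ker (hp : QuasiIso p) (hp' : ∀ m, Function.Surjective (p.f m).hom) :
    ∃ κ : ∀ m, Z.X (m - 1) →ₗ[K] Z.X m, ∀ m x, (p.f (m - 1)).hom x = 0 →
      (p.f m).hom (κ m x) = 0 ∧
      (Z.d m (m - 1)).hom (κ m x) + κ (m - 1) ((Z.d (m - 1) (m - 1 - 1)).hom x) = x := by
  have h (m : ℤ) : ∃ σ : Z.X (m - 1) →ₗ[K] Z.X m, ∀ x, (Z.d (m - 1) (m - 1 - 1)).hom x = 0 →
      (p.f (m - 1)).hom x = 0 → (Z.d m (m - 1)).hom (σ x) = x ∧ (p.f m).hom (σ x) = 0 := by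
    let d' := (Z.d m (m - 1)).hom ∘ₗ (LinearMap.ker (p.f m).hom).subtype
    obtain ⟨s, hs⟩ := d'.rangeRestrict.exists_rightInverse_of_surjective d'.range_rangeRestrict
    obtain ⟨σ, hσ⟩ := LinearMap.exists_extend ((LinearMap.ker (p.f m).hom).subtype ∘ₗ s)
    refine ⟨σ, fun x hx hpx => ?_⟩
    obtain ⟨x', rfl, hx'⟩ := exists_d_eq_of_quasiIso_of_surjective hp hp' m x hx hpx
    have h₁ : σ (d' ⟨x', hx'⟩) = s (d'.rangeRestrict ⟨x', hx'⟩) :=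
      LinearMap.congr_fun hσ (d'.rangeRestrict ⟨x', hx'⟩)
    have h₂ : d' (s (d'.rangeRestrict ⟨x', hx'⟩)) = d' ⟨x', hx'⟩ :=
      congr_arg Subtype.val (LinearMap.congr_fun hs (d'.rangeRestrict ⟨x', hx'⟩))
    change (Z.d m (m - 1)).hom (σ (d' ⟨x', hx'⟩)) = d' ⟨x', hx'⟩ ∧
      (p.f m).hom (σ (d' ⟨x', hx'⟩)) = 0
    rw [h₁]
    exact ⟨h₂, (s (d'.rangeRestrict ⟨x', hx'⟩)).2⟩
  choose σ hσ using h
  have hd (m : ℤ) (x : Z.X (m - 1)) (hpx : (p.f (m - 1)).hom x = 0) :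
      (p.f (m - 1 - 1)).hom ((Z.d (m - 1) (m - 1 - 1)).hom x) = 0 := by
    rw [← map_d_apply, hpx, map_zero]
  -- σ is a primitive on cycles of the kernel only. For x in the kernel, x - σ(dx) is a cycle, so κ
  -- = σ(1 - σd) satisfies dκx = x - σ(dx) and κ(dx) = σ(dx).
  refine ⟨fun m => σ m ∘ₗ (LinearMap.id - σ (m - 1) ∘ₗ (Z.d (m - 1) (m - 1 - 1)).hom),
    fun m x hpx => ?_⟩
  obtain ⟨h₁, h₂⟩ := hσ (m - 1) _ (d_d_apply Z (m - 1) (m - 1 - 1) (m - 1 - 1 - 1) x) (hd m x hpx)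
  obtain ⟨h₃, h₄⟩ := hσ m (x - σ (m - 1) ((Z.d (m - 1) (m - 1 - 1)).hom x))
    (by rw [map_sub, h₁, sub_self]) (by rw [map_sub, h₂, hpx, sub_zero])
  simp only [LinearMap.comp_apply, LinearMap.sub_apply, LinearMap.id_apply]
  refine ⟨h₄, ?_⟩
  rw [h₃, d_d_apply, map_zero, sub_zero, sub_add_cancel]

/-- A surjective quasi-isomorphism of complexes of vector spaces is a strong deformation
retraction. -/
theorem exists_deformationRetraction (hp : QuasiIso p)
    (hp' : ∀ m, Function.Surjective (p.f m).hom) :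
    ∃ (s : T ⟶ Z) (k : ∀ m, Z.X (m - 1) →ₗ[K] Z.X m), s ≫ p = 𝟙 T ∧
      (∀ m x, (p.f m).hom (k m x) = 0) ∧
      ∀ m x, (Z.d m (m - 1)).hom (k m x) + k (m - 1) ((Z.d (m - 1) (m - 1 - 1)).hom x) =
        x - (s.f (m - 1)).hom ((p.f (m - 1)).hom x) := by
  obtain ⟨κ, hκ⟩ := exists_contraction_ker hp hp'
  have ht (m : ℤ) := (p.f m).hom.exists_rightInverse_of_surjective (LinearMap.range_eq_top.2 (hp' m))
  choose t ht using ht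
  replace ht (m : ℤ) (y : T.X m) : (p.f m).hom (t m y) = y := LinearMap.congr_fun (ht m) y
  have hr (m : ℤ) (y : T.X m) : (p.f (m - 1)).hom ((Z.d m (m - 1)).hom (t m y) -
      t (m - 1) ((T.d m (m - 1)).hom y)) = 0 := by
    rw [map_sub, ht, ← map_d_apply, ht, sub_self]
  -- A degreewise linear section t fails to be a chain map by dt - td, which takes values in the
  -- kernel of p; subtracting κ(dt - td) repairs it without changing its composite with p.
  let s : T ⟶ Z :=
    { f := fun m => ModuleCat.ofHom
        (t m - κ m ∘ₗ ((Z.d m (m - 1)).hom ∘ₗ t m - t (m - 1) ∘ₗ (T.d m (m - 1)).hom))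
      comm' := fun m n hmn => by
        obtain rfl : m - 1 = n := by
          have : n + 1 = m := hmn
          omega
        refine ModuleCat.hom_ext (LinearMap.ext fun y => ?_)
        change (Z.d m (m - 1)).hom (t m y - κ m ((Z.d m (m - 1)).hom (t m y) -
            t (m - 1) ((T.d m (m - 1)).hom y))) =
          t (m - 1) ((T.d m (m - 1)).hom y) - κ (m - 1) ((Z.d (m - 1) (m - 1 - 1)).hom
            (t (m - 1) ((T.d m (m - 1)).hom y)) -
            t (m - 1 - 1) ((T.d (m - 1) (m - 1 - 1)).hom ((T.d m (m - 1)).hom y)))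
        have h := (hκ m _ (hr m y)).2
        rw [map_sub (Z.d (m - 1) (m - 1 - 1)).hom, d_d_apply, zero_sub, map_neg] at h
        rw [map_sub, eq_sub_of_add_eq h, d_d_apply, map_zero, sub_zero]
        abel }
  have hs : s ≫ p = 𝟙 T := hom_ext_apply fun m y => by
    change (p.f m).hom (t m y - κ m ((Z.d m (m - 1)).hom (t m y) -
            t (m - 1) ((T.d m (m - 1)).hom y))) = y
    rw [map_sub, ht, (hκ m _ (hr m y)).1, sub_zero]
  have hs' (m : ℤ) (x : Z.X m) : (p.f m).hom (x - (s.f m).hom ((p.f m).hom x)) = 0 := by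
    rw [map_sub, ← comp_apply' s p, hs, sub_eq_zero]
    rfl
  -- The map 1 - sp takes values in the kernel of p, where κ contracts; so κ(1 - sp) is a homotopy
  -- from sp to the identity that stays in the kernel.
  refine ⟨s, fun m => κ m ∘ₗ (LinearMap.id - (s.f (m - 1)).hom ∘ₗ (p.f (m - 1)).hom), hs,
    fun m x => (hκ m _ (hs' _ x)).1, fun m x => ?_⟩
  have h := (hκ m _ (hs' _ x)).2
  rw [map_sub (Z.d (m - 1) (m - 1 - 1)).hom, map_d_apply, map_d_apply] at h
  exact h

end SurjectiveQuasiIso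

/-! ### Chain maps out of a totalization -/

section Tot

variable {A B T : Ch.{v} K} {φ : A ⟶ B}

/-- The chain map out of a totalization that is given by a chain map `b` on vertical degree `0` and a
null-homotopy of `φ ≫ b` on vertical degree `1`. -/
noncomputable def tot.descHomotopy (b : B ⟶ T) (h : ∀ m, A.X (m - 1) →ₗ[K] T.X m)
    (hh : ∀ m x, (T.d m (m - 1)).hom (h m x) =
      ((m - 1).negOnePow : ℤ) • (b.f (m - 1)).hom ((φ.f (m - 1)).hom x) +
        h (m - 1) ((A.d (m - 1) (m - 1 - 1)).hom x)) : tot φ ⟶ T where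
  f m := ModuleCat.ofHom (LinearMap.coprod (b.f m).hom (h m))
  comm' m n hmn := by
    obtain rfl : m - 1 = n := by
      have : n + 1 = m := hmn
      omega
    rw [tot_d]
    refine ModuleCat.hom_ext (LinearMap.ext fun x => ?_)
    obtain ⟨y, x⟩ := x
    change (T.d m (m - 1)).hom ((b.f m).hom y + h m x) =
      (b.f (m - 1)).hom (totD φ m (y, x)).1 + h (m - 1) (totD φ m (y, x)).2
    rw [totD_apply, map_add, hh, map_d_apply, map_add, map_zsmul, add_assoc]

theorem tot_d_apply (m : ℤ) (y : B.X m) (x : A.X (m - 1)) :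
    ((tot φ).d m (m - 1)).hom (y, x) =
      ((B.d m (m - 1)).hom y + ((m - 1).negOnePow : ℤ) • (φ.f (m - 1)).hom x,
        (A.d (m - 1) (m - 1 - 1)).hom x) := by
  rw [tot_d]
  rfl

theorem negOnePow_smul_self {V : Type*} [AddCommGroup V] (m : ℤ) (x : V) :
    (m.negOnePow : ℤ) • (m.negOnePow : ℤ) • x = x := by
  rw [smul_smul, ← Units.val_mul, ← Int.negOnePow_add, Int.negOnePow_even _ (Even.add_self m),
    Units.val_one, one_smul]

theorem negOnePow_sub_one_smul {V : Type*} [AddCommGroup V] (m : ℤ) (x : V) :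
    ((m - 1).negOnePow : ℤ) • x = - ((m.negOnePow : ℤ) • x) := by
  rw [Int.negOnePow_sub m 1]
  simp

/-- If `0 ⟶ A ⟶ B ⟶ T ⟶ 0` is exact in every degree, then the totalization of `A ⟶ B` is
quasi-isomorphic to `T`. -/
theorem tot.quasiIso_desc (b : B ⟶ T) (h : φ ≫ b = 0)
    (hφ : ∀ m, Function.Injective (φ.f m).hom) (hb : ∀ m, Function.Surjective (b.f m).hom)
    (hφb : ∀ m y, (b.f m).hom y = 0 → ∃ x, (φ.f m).hom x = y) : QuasiIso (tot.desc b h) := by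
  rw [quasiIso_iff_forall]
  rintro m ⟨y, x⟩ z hyx hz
  rw [tot_d_apply] at hyx
  obtain ⟨h₁, -⟩ := Prod.ext_iff.1 hyx
  replace h₁ : (B.d (m - 1 - 1) (m - 1 - 1 - 1)).hom y +
    ((m - 1 - 1 - 1).negOnePow : ℤ) • (φ.f (m - 1 - 1 - 1)).hom x = 0 := h₁
  rw [negOnePow_sub_one_smul (m - 1 - 1), add_neg_eq_zero] at h₁
  change (b.f _).hom y = _ at hz
  obtain ⟨y₁, rfl⟩ := hb _ z
  rw [map_d_apply, ← sub_eq_zero, ← map_sub] at hz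
  obtain ⟨x₁, hx₁⟩ := hφb _ _ hz
  -- The sign cancels the one in the totalization, so the first component of the boundary is dy₁ +
  -- φ(x₁) = y. The second component is compared after applying the injective φ.
  refine ⟨(y₁, ((m - 1 - 1).negOnePow : ℤ) • x₁), 0, ?_, ?_⟩
  · rw [tot_d_apply]
    refine Prod.ext ?_ (hφ _ ?_)
    · change _ + _ = y
      rw [map_zsmul, negOnePow_smul_self, hx₁, add_sub_cancel]
    · change (φ.f _).hom ((A.d _ _).hom _) = (φ.f _).hom x
      rw [map_zsmul, map_zsmul, ← map_d_apply, hx₁, map_sub, d_d_apply, sub_zero,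
        h₁, negOnePow_smul_self]
  · rw [map_zero, add_zero]
    rfl

/-- The cone condition is solved first in the column A, and then in the column B for the data
corrected by φ(x₁) and φ'(x₁'). -/
theorem tot.quasiIso_map {A' B' : Ch.{v} K} {φ' : A' ⟶ B'} (a : A ⟶ A') (b : B ⟶ B')
    (h : φ ≫ b = a ≫ φ') (ha : QuasiIso a) (hb : QuasiIso b) : QuasiIso (tot.map a b h) := by
  rw [quasiIso_iff_forall] at ha hb ⊢
  have h' (m : ℤ) (x : A.X m) : (b.f m).hom ((φ.f m).hom x) = (φ'.f m).hom ((a.f m).hom x) :=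
    congr_arg (fun k : A ⟶ B' => (k.f m).hom x) h
  rintro m ⟨y, x⟩ ⟨y', x'⟩ hyx hyx'
  rw [tot_d_apply] at hyx
  change ((b.f (m - 1 - 1)).hom y, (a.f (m - 1 - 1 - 1)).hom x) = _ at hyx'
  rw [tot_d_apply] at hyx'
  obtain ⟨h₁, h₂⟩ := Prod.ext_iff.1 hyx
  obtain ⟨h₃, h₄⟩ := Prod.ext_iff.1 hyx'
  replace h₁ : (B.d (m - 1 - 1) (m - 1 - 1 - 1)).hom y +
    ((m - 1 - 1 - 1).negOnePow : ℤ) • (φ.f (m - 1 - 1 - 1)).hom x = 0 := h₁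
  rw [negOnePow_sub_one_smul (m - 1 - 1), add_neg_eq_zero] at h₁
  replace h₂ : (A.d (m - 1 - 1 - 1) (m - 1 - 1 - 1 - 1)).hom x = 0 := h₂
  replace h₃ : (b.f _).hom y = (B'.d _ _).hom y' + ((m - 1 - 1).negOnePow : ℤ) •
    (φ'.f _).hom x' := h₃
  replace h₄ : (a.f _).hom x = (A'.d _ _).hom x' := h₄
  obtain ⟨x₁, x₁', h₅, h₆⟩ := ha (m - 1) x x' h₂ h₄
  obtain ⟨y₁, y₁', h₇, h₈⟩ := hb m (y - ((m - 1 - 1).negOnePow : ℤ) • (φ.f _).hom x₁)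
    (y' + ((m - 1).negOnePow : ℤ) • (φ'.f _).hom x₁')
    (by
      rw [map_sub, map_zsmul, map_d_apply, h₅, h₁, sub_self])
    (by
      rw [map_sub, map_zsmul, h', h₆, h₃, map_add, map_add, map_zsmul, map_d_apply, smul_add]
      simp only [negOnePow_sub_one_smul (m - 1)]
      abel)
  refine ⟨(y₁, x₁), (y₁', x₁'), ?_, ?_⟩
  · rw [tot_d_apply]
    refine Prod.ext ?_ h₅
    change _ + _ = y
    rw [h₇, sub_add_cancel]
  · rw [tot_d_apply]
    refine Prod.ext ?_ h₆
    change (b.f _).hom y₁ = y' + (_ + _)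
    rw [h₈]
    abel

end Tot

/-! ### Direct sums -/

section DirectSum

variable {ι : Type} {Z T : ι → Ch.{v} K}

theorem dirSum.linearMap_ext {m : ℤ} {V : Type*} [AddCommGroup V] [Module K V]
    {s t : (dirSum Z).X m →ₗ[K] V}
    (h : ∀ i x, s (((dirSum.incl Z i).f m).hom x) = t (((dirSum.incl Z i).f m).hom x)) : s = t := by
  classical
  exact DirectSum.linearMap_ext K fun i => LinearMap.ext fun x => h i x

/-- The linear map out of a degree of a direct sum that is given by a family of linear maps. -/
noncomputable def dirSum.descLinear {m : ℤ} {V : Type*} [AddCommGroup V] [Module K V]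
    (t : ∀ i, (Z i).X m →ₗ[K] V) : (dirSum Z).X m →ₗ[K] V := by
  classical exact DirectSum.toModule K ι V t

theorem dirSum.descLinear_incl {m : ℤ} {V : Type*} [AddCommGroup V] [Module K V]
    (t : ∀ i, (Z i).X m →ₗ[K] V) (i : ι) (x : (Z i).X m) :
    dirSum.descLinear t (((dirSum.incl Z i).f m).hom x) = t i x := by
  classical
  exact DirectSum.toModule_lof K (M := fun i => ((Z i).X m : Type v)) (φ := t) i x

/-- The projection to a summand. -/
noncomputable def dirSum.proj (Z : ι → Ch.{v} K) (i : ι) (m : ℤ) :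
    (dirSum Z).X m →ₗ[K] (Z i).X m :=
  DirectSum.component K ι (fun i => (Z i).X m) i

theorem dirSum.proj_ext {m : ℤ} {x y : (dirSum Z).X m}
    (h : ∀ i, dirSum.proj Z i m x = dirSum.proj Z i m y) : x = y :=
  DFinsupp.ext h

theorem dirSum.proj_d (i : ι) (m n : ℤ) (x : (dirSum Z).X m) :
    dirSum.proj Z i n (((dirSum Z).d m n).hom x) = ((Z i).d m n).hom (dirSum.proj Z i m x) := by
  classical
  exact DFinsupp.mapRange_apply (β₁ := fun i => ((Z i).X m : Type v))
    (β₂ := fun i => ((Z i).X n : Type v)) (fun i => ((Z i).d m n).hom) (fun i => map_zero _) x i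

theorem dirSum.proj_incl_self (i : ι) (m : ℤ) (x : (Z i).X m) :
    dirSum.proj Z i m (((dirSum.incl Z i).f m).hom x) = x := by
  classical
  exact DirectSum.component.lof_self K (M := fun i => ((Z i).X m : Type v)) i x

theorem dirSum.proj_incl_of_ne {i j : ι} (h : i ≠ j) (m : ℤ) (x : (Z i).X m) :
    dirSum.proj Z j m (((dirSum.incl Z i).f m).hom x) = 0 := by
  classical
  exact DirectSum.of_eq_of_ne (β := fun i => ((Z i).X m : Type v)) _ _ _ h.symm

theorem dirSum.proj_desc (t : ∀ i, Z i ⟶ T i) (i : ι) (m : ℤ) (x : (dirSum Z).X m) :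
    dirSum.proj T i m (((dirSum.desc fun i => t i ≫ dirSum.incl T i).f m).hom x) =
      ((t i).f m).hom (dirSum.proj Z i m x) := by
  refine LinearMap.congr_fun (f := dirSum.proj T i m ∘ₗ
    ((dirSum.desc fun i => t i ≫ dirSum.incl T i).f m).hom)
    (g := ((t i).f m).hom ∘ₗ dirSum.proj Z i m) (dirSum.linearMap_ext fun j x => ?_) x
  rw [LinearMap.comp_apply, LinearMap.comp_apply, ← comp_apply', dirSum.incl_desc, comp_apply']
  obtain rfl | h := eq_or_ne j i
  · rw [dirSum.proj_incl_self, dirSum.proj_incl_self]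
  · rw [dirSum.proj_incl_of_ne h, dirSum.proj_incl_of_ne h, map_zero]

theorem dirSum.exists_proj_eq {m : ℤ} (s : Finset ι) (x : ∀ i, (Z i).X m) :
    ∃ y : (dirSum Z).X m, (∀ i ∈ s, dirSum.proj Z i m y = x i) ∧
      ∀ i ∉ s, dirSum.proj Z i m y = 0 := by
  classical
  refine ⟨DFinsupp.mk (β := fun i => ((Z i).X m : Type v)) s fun i => x i, fun i hi => ?_, fun i hi => ?_⟩
  · exact (DFinsupp.mk_apply (β := fun i => ((Z i).X m : Type v)) (x := fun i => x i)).trans (dif_pos hi)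
  · exact (DFinsupp.mk_apply (β := fun i => ((Z i).X m : Type v)) (x := fun i => x i)).trans (dif_neg hi)

theorem dirSum.exists_support {m : ℤ} (x : (dirSum Z).X m) :
    ∃ s : Finset ι, ∀ i ∉ s, dirSum.proj Z i m x = 0 := by
  classical
  exact ⟨DFinsupp.support (β := fun i => ((Z i).X m : Type v)) x, fun i hi => DFinsupp.notMem_support_iff.1 hi⟩

/-- The cone condition is solved summand by summand. The chosen solutions are kept only on a finite
set containing the supports of x and y; elsewhere zero is a solution. -/
theorem dirSum.quasiIso_desc (t : ∀ i, Z i ⟶ T i) (ht : ∀ i, QuasiIso (t i)) :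
    QuasiIso (dirSum.desc fun i => t i ≫ dirSum.incl T i) := by
  classical
  simp only [quasiIso_iff_forall] at ht ⊢
  intro m x y hx hxy
  obtain ⟨s₁, hs₁⟩ := dirSum.exists_support x
  obtain ⟨s₂, hs₂⟩ := dirSum.exists_support y
  have h (i : ι) := ht i m (dirSum.proj Z i _ x) (dirSum.proj T i _ y)
    (by rw [← dirSum.proj_d, hx, map_zero]) (by rw [← dirSum.proj_desc, hxy, dirSum.proj_d])
  choose a b ha hb using h
  obtain ⟨x', h₁, h₂⟩ := dirSum.exists_proj_eq (s₁ ∪ s₂) a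
  obtain ⟨y', h₃, h₄⟩ := dirSum.exists_proj_eq (s₁ ∪ s₂) b
  refine ⟨x', y', dirSum.proj_ext fun i => ?_, dirSum.proj_ext fun i => ?_⟩
  · rw [dirSum.proj_d]
    by_cases hi : i ∈ s₁ ∪ s₂
    · rw [h₁ i hi, ha]
    · rw [h₂ i hi, map_zero, hs₁ i fun h => hi (Finset.mem_union_left _ h)]
  · rw [dirSum.proj_desc, map_add, dirSum.proj_d]
    by_cases hi : i ∈ s₁ ∪ s₂
    · rw [h₁ i hi, h₃ i hi, hb]
    · rw [h₂ i hi, h₄ i hi, map_zero, map_zero, hs₂ i fun h => hi (Finset.mem_union_right _ h),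
        add_zero]

end DirectSum

/-! ### Generators of the bar construction and morphisms out of it -/

section TotElements

variable {A B A' B' T : Ch.{v} K} {φ : A ⟶ B} {φ' : A' ⟶ B'}

variable (φ) in
/-- The inclusion of vertical degree `0` into a totalization. -/
noncomputable def tot.inl : B ⟶ tot φ where
  f m := ModuleCat.ofHom (LinearMap.inl K (B.X m) (A.X (m - 1)))
  comm' m n hmn := by
    obtain rfl : m - 1 = n := by
      have : n + 1 = m := hmn
      omega
    refine ModuleCat.hom_ext (LinearMap.ext fun x => ?_)
    refine (tot_d_apply (φ := φ) m x 0).trans ?_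
    rw [map_zero, map_zero, smul_zero, add_zero]
    rfl

variable (φ) in
/-- The inclusion of vertical degree `1` into a degree of a totalization. -/
noncomputable def tot.inr (m : ℤ) : A.X (m - 1) →ₗ[K] (tot φ).X m :=
  LinearMap.inr K (B.X m) (A.X (m - 1))

theorem tot.d_inr (m : ℤ) (x : A.X (m - 1)) :
    ((tot φ).d m (m - 1)).hom (tot.inr φ m x) =
      ((m - 1).negOnePow : ℤ) • ((tot.inl φ).f (m - 1)).hom ((φ.f (m - 1)).hom x) +
        tot.inr φ (m - 1) ((A.d (m - 1) (m - 1 - 1)).hom x) := by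
  refine (tot_d_apply (φ := φ) m 0 x).trans (Prod.ext ?_ ?_)
  · rw [map_zero]
    exact (zero_add _).trans (add_zero _).symm
  · change _ = ((m - 1).negOnePow : ℤ) • (0 : A.X (m - 1 - 1)) + _
    rw [smul_zero, zero_add]
    rfl

theorem tot.linearMap_ext {m : ℤ} {V : Type*} [AddCommGroup V] [Module K V]
    {s t : (tot φ).X m →ₗ[K] V}
    (h₀ : ∀ x, s (((tot.inl φ).f m).hom x) = t (((tot.inl φ).f m).hom x))
    (h₁ : ∀ x, s (tot.inr φ m x) = t (tot.inr φ m x)) : s = t :=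
  LinearMap.prod_ext (LinearMap.ext h₀) (LinearMap.ext h₁)

theorem tot.map_inl (a : A ⟶ A') (b : B ⟶ B') (h : φ ≫ b = a ≫ φ') (m : ℤ) (x : B.X m) :
    ((tot.map a b h).f m).hom (((tot.inl φ).f m).hom x) =
      ((tot.inl φ').f m).hom ((b.f m).hom x) :=
  Prod.ext rfl (map_zero (a.f (m - 1)).hom)

theorem tot.map_inr (a : A ⟶ A') (b : B ⟶ B') (h : φ ≫ b = a ≫ φ') (m : ℤ) (x : A.X (m - 1)) :
    ((tot.map a b h).f m).hom (tot.inr φ m x) = tot.inr φ' m ((a.f (m - 1)).hom x) :=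
  Prod.ext (map_zero (b.f m).hom) rfl

theorem tot.desc_inr (b : B ⟶ T) (h : φ ≫ b = 0) (m : ℤ) (x : A.X (m - 1)) :
    ((tot.desc b h).f m).hom (tot.inr φ m x) = 0 :=
  map_zero (b.f m).hom

theorem tot.descHomotopy_inl (b : B ⟶ T) (h : ∀ m, A.X (m - 1) →ₗ[K] T.X m)
    (hh : ∀ m x, (T.d m (m - 1)).hom (h m x) =
      ((m - 1).negOnePow : ℤ) • (b.f (m - 1)).hom ((φ.f (m - 1)).hom x) +
        h (m - 1) ((A.d (m - 1) (m - 1 - 1)).hom x)) (m : ℤ) (x : B.X m) :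
    ((tot.descHomotopy b h hh).f m).hom (((tot.inl φ).f m).hom x) = (b.f m).hom x :=
  (congr_arg (fun y => (b.f m).hom x + y) (map_zero (h m))).trans (add_zero _)

theorem tot.descHomotopy_inr (b : B ⟶ T) (h : ∀ m, A.X (m - 1) →ₗ[K] T.X m)
    (hh : ∀ m x, (T.d m (m - 1)).hom (h m x) =
      ((m - 1).negOnePow : ℤ) • (b.f (m - 1)).hom ((φ.f (m - 1)).hom x) +
        h (m - 1) ((A.d (m - 1) (m - 1 - 1)).hom x)) (m : ℤ) (x : A.X (m - 1)) :
    ((tot.descHomotopy b h hh).f m).hom (tot.inr φ m x) = h m x :=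
  (congr_arg (fun y => y + h m x) (map_zero (b.f m).hom)).trans (zero_add _)

end TotElements

section BarGenerators

variable {D : Type} [SmallCategory D] {F : Obj ⥤ D} {E : Type} [SmallCategory E] {G : Obj ⥤ E}
variable {X X' : Obj ⥤ Ch.{v} K} {d : D} {e : E} {T : Ch.{v} K}

theorem bar₀_linearMap_ext {m : ℤ} {V : Type*} [AddCommGroup V] [Module K V]
    {s t : (bar₀ F X d).X m →ₗ[K] V}
    (h : ∀ c (g : F.obj c ⟶ d) x, s (((incl₀ X g).f m).hom x) = t (((incl₀ X g).f m).hom x)) :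
    s = t :=
  dirSum.linearMap_ext fun i x => h i.1 i.2 x

theorem bar₁_linearMap_ext {m : ℤ} {V : Type*} [AddCommGroup V] [Module K V]
    {s t : (bar₁ F X d).X m →ₗ[K] V}
    (h : ∀ f (g : F.obj f.tgt ⟶ d) x,
      s (((incl₁ X f g).f m).hom x) = t (((incl₁ X f g).f m).hom x)) : s = t :=
  dirSum.linearMap_ext fun i x => h i.1 i.2 x

/-- The linear map `(c, g, x) ↦ t c g x`. -/
noncomputable def descLinear₀ {m : ℤ} {V : Type*} [AddCommGroup V] [Module K V]
    (t : ∀ c, (F.obj c ⟶ d) → ((X.obj c).X m →ₗ[K] V)) : (bar₀ F X d).X m →ₗ[K] V :=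
  dirSum.descLinear fun i => t i.1 i.2

/-- The linear map `(t f, g, f, x) ↦ t f g x`. -/
noncomputable def descLinear₁ {m : ℤ} {V : Type*} [AddCommGroup V] [Module K V]
    (t : ∀ f : Arr, (F.obj f.tgt ⟶ d) → ((X.obj f.src).X m →ₗ[K] V)) :
    (bar₁ F X d).X m →ₗ[K] V :=
  dirSum.descLinear fun i => t i.1 i.2

theorem descLinear₀_incl₀ {m : ℤ} {V : Type*} [AddCommGroup V] [Module K V]
    (t : ∀ c, (F.obj c ⟶ d) → ((X.obj c).X m →ₗ[K] V)) {c : Obj} (g : F.obj c ⟶ d)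
    (x : (X.obj c).X m) : descLinear₀ t (((incl₀ X g).f m).hom x) = t c g x :=
  dirSum.descLinear_incl (Z := fun i : (Σ c : Obj, F.obj c ⟶ d) => X.obj i.1)
    (fun i => t i.1 i.2) ⟨c, g⟩ x

theorem descLinear₁_incl₁ {m : ℤ} {V : Type*} [AddCommGroup V] [Module K V]
    (t : ∀ f : Arr, (F.obj f.tgt ⟶ d) → ((X.obj f.src).X m →ₗ[K] V)) (f : Arr)
    (g : F.obj f.tgt ⟶ d) (x : (X.obj f.src).X m) :
    descLinear₁ t (((incl₁ X f g).f m).hom x) = t f g x :=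
  dirSum.descLinear_incl (Z := fun i : (Σ f : Arr, F.obj f.tgt ⟶ d) => X.obj i.1.src)
    (fun i => t i.1 i.2) ⟨f, g⟩ x

theorem barδ_incl₁ (f : Arr) (g : F.obj f.tgt ⟶ d) (m : ℤ) (x : (X.obj f.src).X m) :
    ((barδ F X d).f m).hom (((incl₁ X f g).f m).hom x) =
      ((incl₀ X (F.map f.hom ≫ g)).f m).hom x -
        ((incl₀ X g).f m).hom (((X.map f.hom).f m).hom x) := by
  rw [← comp_apply', barδ, incl_desc₁]
  rfl

variable (X) in
/-- The inclusion `x ↦ (c, g, x)` of a generating complex into the bar construction. -/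
noncomputable def gen₀ {c : Obj} (g : F.obj c ⟶ d) : X.obj c ⟶ ((bar F).obj X).obj d :=
  incl₀ X g ≫ tot.inl (barδ F X d)

variable (X) in
/-- The inclusion `x ↦ (t f, g, f, x)` of a generating space into the bar construction. -/
noncomputable def gen₁ (f : Arr) (g : F.obj f.tgt ⟶ d) (m : ℤ) :
    (X.obj f.src).X (m - 1) →ₗ[K] (((bar F).obj X).obj d).X m :=
  tot.inr (barδ F X d) m ∘ₗ ((incl₁ X f g).f (m - 1)).hom

theorem d_gen₁ (f : Arr) (g : F.obj f.tgt ⟶ d) (m : ℤ) (x : (X.obj f.src).X (m - 1)) :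
    ((((bar F).obj X).obj d).d m (m - 1)).hom (gen₁ X f g m x) =
      ((m - 1).negOnePow : ℤ) • (((gen₀ X (F.map f.hom ≫ g)).f (m - 1)).hom x -
        ((gen₀ X g).f (m - 1)).hom (((X.map f.hom).f (m - 1)).hom x)) +
      gen₁ X f g (m - 1) (((X.obj f.src).d (m - 1) (m - 1 - 1)).hom x) := by
  have h := tot.d_inr (φ := barδ F X d) m (((incl₁ X f g).f (m - 1)).hom x)
  rw [barδ_incl₁, map_sub, map_d_apply] at h
  exact h

theorem barObj_linearMap_ext {m : ℤ} {V : Type*} [AddCommGroup V] [Module K V]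
    {s t : (((bar F).obj X).obj d).X m →ₗ[K] V}
    (h₀ : ∀ c (g : F.obj c ⟶ d) x, s (((gen₀ X g).f m).hom x) = t (((gen₀ X g).f m).hom x))
    (h₁ : ∀ f (g : F.obj f.tgt ⟶ d) x, s (gen₁ X f g m x) = t (gen₁ X f g m x)) : s = t :=
  tot.linearMap_ext (φ := barδ F X d)
    (LinearMap.congr_fun (f := s ∘ₗ ((tot.inl (barδ F X d)).f m).hom)
      (g := t ∘ₗ ((tot.inl (barδ F X d)).f m).hom) (bar₀_linearMap_ext h₀))
    (LinearMap.congr_fun (f := s ∘ₗ tot.inr (barδ F X d) m)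
      (g := t ∘ₗ tot.inr (barδ F X d) m) (bar₁_linearMap_ext h₁))

theorem barObj_hom_ext {s t : ((bar F).obj X).obj d ⟶ T}
    (h₀ : ∀ c (g : F.obj c ⟶ d) m x,
      (s.f m).hom (((gen₀ X g).f m).hom x) = (t.f m).hom (((gen₀ X g).f m).hom x))
    (h₁ : ∀ f (g : F.obj f.tgt ⟶ d) m x, (s.f m).hom (gen₁ X f g m x) =
      (t.f m).hom (gen₁ X f g m x)) : s = t :=
  HomologicalComplex.Hom.ext (funext fun m => ModuleCat.hom_ext (barObj_linearMap_ext
    (fun c g x => h₀ c g m x) fun f g x => h₁ f g m x))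

theorem barHom_inl (r : ∀ c, (F.obj c ⟶ d) → (G.obj c ⟶ e))
    (hr : ∀ (f : Arr) (g : F.obj f.tgt ⟶ d), r _ (F.map f.hom ≫ g) = G.map f.hom ≫ r _ g)
    (ζ : X ⟶ X') {c : Obj} (g : F.obj c ⟶ d) (m : ℤ) (x : (X.obj c).X m) :
    ((barHom r hr ζ).f m).hom (((tot.inl (barδ F X d)).f m).hom (((incl₀ X g).f m).hom x)) =
      ((tot.inl (barδ G X' e)).f m).hom
        (((incl₀ X' (r c g)).f m).hom (((ζ.app c).f m).hom x)) := by
  refine (tot.map_inl _ _ (barδ_comm r hr ζ) _ _).trans ?_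
  rw [← comp_apply' (incl₀ X g), incl_desc₀]
  rfl

theorem barHom_inr (r : ∀ c, (F.obj c ⟶ d) → (G.obj c ⟶ e))
    (hr : ∀ (f : Arr) (g : F.obj f.tgt ⟶ d), r _ (F.map f.hom ≫ g) = G.map f.hom ≫ r _ g)
    (ζ : X ⟶ X') (f : Arr) (g : F.obj f.tgt ⟶ d) (m : ℤ) (x : (X.obj f.src).X (m - 1)) :
    ((barHom r hr ζ).f m).hom (tot.inr (barδ F X d) m (((incl₁ X f g).f (m - 1)).hom x)) =
      tot.inr (barδ G X' e) m
        (((incl₁ X' f (r _ g)).f (m - 1)).hom (((ζ.app f.src).f (m - 1)).hom x)) := by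
  refine (tot.map_inr _ _ (barδ_comm r hr ζ) _ _).trans ?_
  rw [← comp_apply' (incl₁ X f g), incl_desc₁]
  rfl

theorem bar_map_gen₀ {c : Obj} (g : F.obj c ⟶ d) {d' : D} (k : d ⟶ d') (m : ℤ)
    (x : (X.obj c).X m) :
    ((((bar F).obj X).map k).f m).hom (((gen₀ X g).f m).hom x) =
      ((gen₀ X (g ≫ k)).f m).hom x :=
  barHom_inl _ (fun _ _ => Category.assoc _ _ _) (𝟙 X) g m x

theorem bar_map_gen₁ (f : Arr) (g : F.obj f.tgt ⟶ d) {d' : D} (k : d ⟶ d') (m : ℤ)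
    (x : (X.obj f.src).X (m - 1)) :
    ((((bar F).obj X).map k).f m).hom (gen₁ X f g m x) = gen₁ X f (g ≫ k) m x :=
  barHom_inr _ (fun _ _ => Category.assoc _ _ _) (𝟙 X) f g m x

theorem barUnit_gen₀ {c N : Obj} (g : c ⟶ N) (m : ℤ) (x : (X.obj c).X m) :
    ((((barUnit K F).app X).app N).f m).hom (((gen₀ (F := 𝟭 Obj) X g).f m).hom x) =
      ((gen₀ X (F.map g)).f m).hom x :=
  barHom_inl (F := 𝟭 Obj) (d := N) (fun _ g => F.map g) (fun _ _ => F.map_comp _ _) (𝟙 X) g m x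

theorem barUnit_gen₁ {N : Obj} (f : Arr) (g : f.tgt ⟶ N) (m : ℤ) (x : (X.obj f.src).X (m - 1)) :
    ((((barUnit K F).app X).app N).f m).hom (gen₁ (F := 𝟭 Obj) X f g m x) =
      gen₁ X f (F.map g) m x :=
  barHom_inr (F := 𝟭 Obj) (d := N) (fun _ g => F.map g) (fun _ _ => F.map_comp _ _) (𝟙 X) f g m x

variable {Y Y' : D ⥤ Ch.{v} K}

theorem barCounit_gen₀ {c : Obj} (g : F.obj c ⟶ d) (m : ℤ) (x : (Y.obj (F.obj c)).X m) :
    ((((barCounit K F).app Y).app d).f m).hom (((gen₀ (F ⋙ Y) g).f m).hom x) =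
      ((Y.map g).f m).hom x :=
  congr_arg (fun k : Y.obj (F.obj c) ⟶ Y.obj d => (k.f m).hom x)
    (incl_desc₀ (X := F ⋙ Y) (fun _ g => Y.map g) g)

theorem barCounit_gen₁ (f : Arr) (g : F.obj f.tgt ⟶ d) (m : ℤ)
    (x : (Y.obj (F.obj f.src)).X (m - 1)) :
    ((((barCounit K F).app Y).app d).f m).hom (gen₁ (F ⋙ Y) f g m x) = 0 :=
  tot.desc_inr (desc₀ (X := F ⋙ Y) fun _ g => Y.map g)
    (barδ_desc _ fun _ _ => Y.map_comp _ _) m _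

theorem naturality_apply {J : Type} [SmallCategory J] {P R : J ⥤ Ch.{v} K} (s : P ⟶ R) {i j : J}
    (k : i ⟶ j) (m : ℤ) (x : (P.obj i).X m) :
    ((s.app j).f m).hom (((P.map k).f m).hom x) = ((R.map k).f m).hom (((s.app i).f m).hom x) := by
  rw [← comp_apply', s.naturality, comp_apply']

/-- Over `D` the bar construction is generated by the elements with g = id, since g carries (c, id,
x) to (c, g, x), and likewise in vertical degree one. -/
theorem bar_hom_ext {s t : (bar F).obj X ⟶ Y}
    (h₀ : ∀ c m x, ((s.app (F.obj c)).f m).hom (((gen₀ X (𝟙 (F.obj c))).f m).hom x) =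
      ((t.app (F.obj c)).f m).hom (((gen₀ X (𝟙 (F.obj c))).f m).hom x))
    (h₁ : ∀ f m x, ((s.app (F.obj f.tgt)).f m).hom (gen₁ X f (𝟙 _) m x) =
      ((t.app (F.obj f.tgt)).f m).hom (gen₁ X f (𝟙 _) m x)) : s = t := by
  refine NatTrans.ext (funext fun d => barObj_hom_ext (fun c g m x => ?_) fun f g m x => ?_)
  · have h := bar_map_gen₀ (X := X) (𝟙 (F.obj c)) g m x
    rw [Category.id_comp] at h
    rw [← h, naturality_apply, naturality_apply, h₀]
  · have h := bar_map_gen₁ (X := X) f (𝟙 (F.obj f.tgt)) g m x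
    rw [Category.id_comp] at h
    rw [← h, naturality_apply, naturality_apply, h₁]

variable (F X Y) in
/-- The data of a morphism from a bar construction to `Y`: chain maps out of the values of `X` that
are natural up to specified homotopies. -/
structure BarData where
  /-- the chain maps `x ↦ (c, id, x)` -/
  app (c : Obj) : X.obj c ⟶ Y.obj (F.obj c)
  /-- the homotopies `x ↦ (t f, id, f, x)` -/
  htpy (f : Arr) (m : ℤ) : (X.obj f.src).X (m - 1) →ₗ[K] (Y.obj (F.obj f.tgt)).X m
  -- This is the image of `d_gen₁` for g = id. No relation between homotopies of different arrows is
  -- imposed, because non-identity arrows never compose.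
  d_htpy (f : Arr) (m : ℤ) (x : (X.obj f.src).X (m - 1)) :
    ((Y.obj (F.obj f.tgt)).d m (m - 1)).hom (htpy f m x) =
      ((m - 1).negOnePow : ℤ) • (((Y.map (F.map f.hom)).f (m - 1)).hom
          (((app f.src).f (m - 1)).hom x) -
        ((app f.tgt).f (m - 1)).hom (((X.map f.hom).f (m - 1)).hom x)) +
      htpy f (m - 1) (((X.obj f.src).d (m - 1) (m - 1 - 1)).hom x)

/-! ### Morphisms out of a bar construction as chain maps with homotopies -/

namespace BarData

variable (δ : BarData F X Y)

/-- The part of vertical degree `0` of the morphism that is given by a `BarData`. -/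
noncomputable def desc₀ (d : D) : bar₀ F X d ⟶ Y.obj d :=
  RCE.desc₀ fun c g => δ.app c ≫ Y.map g

/-- The part of vertical degree `1` of the morphism that is given by a `BarData`. -/
noncomputable def desc₁ (d : D) (m : ℤ) : (bar₁ F X d).X (m - 1) →ₗ[K] (Y.obj d).X m :=
  descLinear₁ fun f g => ((Y.map g).f m).hom ∘ₗ δ.htpy f m

theorem desc₀_incl₀ {c : Obj} (g : F.obj c ⟶ d) (m : ℤ) (x : (X.obj c).X m) :
    ((δ.desc₀ d).f m).hom (((incl₀ X g).f m).hom x) =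
      ((Y.map g).f m).hom (((δ.app c).f m).hom x) := by
  rw [← comp_apply', desc₀, incl_desc₀, comp_apply']

theorem desc₁_incl₁ (f : Arr) (g : F.obj f.tgt ⟶ d) (m : ℤ) (x : (X.obj f.src).X (m - 1)) :
    δ.desc₁ d m (((incl₁ X f g).f (m - 1)).hom x) = ((Y.map g).f m).hom (δ.htpy f m x) := by
  rw [desc₁, descLinear₁_incl₁, LinearMap.comp_apply]

theorem d_desc₁ (d : D) (m : ℤ) (x : (bar₁ F X d).X (m - 1)) :
    ((Y.obj d).d m (m - 1)).hom (δ.desc₁ d m x) =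
      ((m - 1).negOnePow : ℤ) •
        ((δ.desc₀ d).f (m - 1)).hom (((barδ F X d).f (m - 1)).hom x) +
      δ.desc₁ d (m - 1) (((bar₁ F X d).d (m - 1) (m - 1 - 1)).hom x) := by
  refine LinearMap.congr_fun (f := ((Y.obj d).d m (m - 1)).hom ∘ₗ δ.desc₁ d m)
    (g := ((m - 1).negOnePow : ℤ) • ((δ.desc₀ d).f (m - 1)).hom ∘ₗ ((barδ F X d).f (m - 1)).hom +
      δ.desc₁ d (m - 1) ∘ₗ ((bar₁ F X d).d (m - 1) (m - 1 - 1)).hom)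
    (bar₁_linearMap_ext fun f g x => ?_) x
  simp only [LinearMap.comp_apply, LinearMap.add_apply, LinearMap.smul_apply]
  rw [desc₁_incl₁, map_d_apply, δ.d_htpy, barδ_incl₁, map_sub, desc₀_incl₀, desc₀_incl₀,
    map_d_apply, desc₁_incl₁, map_add, map_zsmul, map_sub, Y.map_comp, comp_apply']

/-- The morphism out of a bar construction that is given by a `BarData`. -/
noncomputable def descApp (d : D) : ((bar F).obj X).obj d ⟶ Y.obj d :=
  tot.descHomotopy (δ.desc₀ d) (δ.desc₁ d) (δ.d_desc₁ d)

theorem descApp_gen₀ {c : Obj} (g : F.obj c ⟶ d) (m : ℤ) (x : (X.obj c).X m) :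
    ((δ.descApp d).f m).hom (((gen₀ X g).f m).hom x) =
      ((Y.map g).f m).hom (((δ.app c).f m).hom x) :=
  (tot.descHomotopy_inl _ _ _ _ _).trans (δ.desc₀_incl₀ g m x)

theorem descApp_gen₁ (f : Arr) (g : F.obj f.tgt ⟶ d) (m : ℤ) (x : (X.obj f.src).X (m - 1)) :
    ((δ.descApp d).f m).hom (gen₁ X f g m x) = ((Y.map g).f m).hom (δ.htpy f m x) :=
  (tot.descHomotopy_inr _ _ _ _ _).trans (δ.desc₁_incl₁ f g m x)

/-- The morphism out of a bar construction that is given by a `BarData`. -/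
noncomputable def desc : (bar F).obj X ⟶ Y where
  app d := δ.descApp d
  naturality d d' k := barObj_hom_ext
    (fun c g m x => by
      rw [comp_apply', comp_apply', bar_map_gen₀, descApp_gen₀, descApp_gen₀, Y.map_comp,
        comp_apply'])
    (fun f g m x => by
      rw [comp_apply', comp_apply', bar_map_gen₁, descApp_gen₁, descApp_gen₁, Y.map_comp,
        comp_apply'])

theorem desc_gen₀ {c : Obj} (g : F.obj c ⟶ d) (m : ℤ) (x : (X.obj c).X m) :
    ((δ.desc.app d).f m).hom (((gen₀ X g).f m).hom x) =
      ((Y.map g).f m).hom (((δ.app c).f m).hom x) :=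
  δ.descApp_gen₀ g m x

theorem desc_gen₁ (f : Arr) (g : F.obj f.tgt ⟶ d) (m : ℤ) (x : (X.obj f.src).X (m - 1)) :
    ((δ.desc.app d).f m).hom (gen₁ X f g m x) = ((Y.map g).f m).hom (δ.htpy f m x) :=
  δ.descApp_gen₁ f g m x

theorem desc_gen₀_id (c : Obj) (m : ℤ) (x : (X.obj c).X m) :
    ((δ.desc.app (F.obj c)).f m).hom (((gen₀ X (𝟙 (F.obj c))).f m).hom x) =
      ((δ.app c).f m).hom x := by
  rw [desc_gen₀, Y.map_id]
  rfl

theorem desc_gen₁_id (f : Arr) (m : ℤ) (x : (X.obj f.src).X (m - 1)) :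
    ((δ.desc.app (F.obj f.tgt)).f m).hom (gen₁ X f (𝟙 _) m x) = δ.htpy f m x := by
  rw [desc_gen₁, Y.map_id]
  rfl

/-- The `BarData` of a morphism out of a bar construction. -/
noncomputable def ofHom (s : (bar F).obj X ⟶ Y) : BarData F X Y where
  app c := gen₀ X (𝟙 (F.obj c)) ≫ s.app (F.obj c)
  htpy f m := ((s.app (F.obj f.tgt)).f m).hom ∘ₗ gen₁ X f (𝟙 _) m
  d_htpy f m x := by
    have h := bar_map_gen₀ (X := X) (𝟙 (F.obj f.src)) (F.map f.hom) (m - 1) x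
    rw [Category.id_comp] at h
    rw [LinearMap.comp_apply, LinearMap.comp_apply, map_d_apply, d_gen₁, map_add, map_zsmul, map_sub,
      comp_apply', comp_apply', Category.comp_id, ← h, naturality_apply]

end BarData

end BarGenerators

/-! ### Cofibrancy of bar constructions and the Quillen adjunction -/

section Model

variable {D : Type} [SmallCategory D] {F : Obj ⥤ D} {X : Obj ⥤ Ch.{v} K} {A B : D ⥤ Ch.{v} K}

/-- The chain maps lift through sections s(d) of p, chosen separately for each d. These need not be
natural in d, so the homotopies must absorb the new naturality defect t, which the deformations k(d)
of the fibres make possible. -/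
theorem BarData.exists_lift (δ : BarData F X B) (p : A ⟶ B) (hp : weakEq K D p) (hp' : fib K D p) :
    ∃ δ' : BarData F X A, (∀ c, δ'.app c ≫ p.app (F.obj c) = δ.app c) ∧
      ∀ f m x, ((p.app (F.obj f.tgt)).f m).hom (δ'.htpy f m x) = δ.htpy f m x := by
  choose s k hs hpk hk using fun d => exists_deformationRetraction (hp d) (hp' d)
  have hs' (d : D) (m : ℤ) (x : (B.obj d).X m) :
      ((p.app d).f m).hom (((s d).f m).hom x) = x :=
    congr_arg (fun t : B.obj d ⟶ B.obj d => (t.f m).hom x) (hs d)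
  let a (c : Obj) : X.obj c ⟶ A.obj (F.obj c) := δ.app c ≫ s (F.obj c)
  have ha (c : Obj) : a c ≫ p.app (F.obj c) = δ.app c := by rw [Category.assoc, hs, Category.comp_id]
  have ha' (c : Obj) (m : ℤ) (x : (X.obj c).X m) :
      ((p.app (F.obj c)).f m).hom (((a c).f m).hom x) = ((δ.app c).f m).hom x := hs' _ _ _
  let t (f : Arr) : X.obj f.src ⟶ A.obj (F.obj f.tgt) :=
    a f.src ≫ A.map (F.map f.hom) - X.map f.hom ≫ a f.tgt
  have ht (f : Arr) (m : ℤ) (x : (X.obj f.src).X m) : ((t f).f m).hom x =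
      ((A.map (F.map f.hom)).f m).hom (((a f.src).f m).hom x) -
        ((a f.tgt).f m).hom (((X.map f.hom).f m).hom x) := rfl
  refine ⟨{
    app := a
    -- Since dk + kd = 1 - sp, the second summand bounds t - spt up to sign. As pt is the naturality
    -- defect of δ, the first summand accounts for spt. Applying p kills the correction because pk =
    -- 0.
    htpy := fun f m => ((s (F.obj f.tgt)).f m).hom ∘ₗ δ.htpy f m +
      ((m - 1).negOnePow : ℤ) • k (F.obj f.tgt) m ∘ₗ ((t f).f (m - 1)).hom
    d_htpy := fun f m x => ?_ }, ha, fun f m x => ?_⟩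
  · have h := hk (F.obj f.tgt) m (((t f).f (m - 1)).hom x)
    have h' : ((p.app (F.obj f.tgt)).f (m - 1)).hom (((t f).f (m - 1)).hom x) =
        ((B.map (F.map f.hom)).f (m - 1)).hom (((δ.app f.src).f (m - 1)).hom x) -
          ((δ.app f.tgt).f (m - 1)).hom (((X.map f.hom).f (m - 1)).hom x) := by
      rw [ht, map_sub, naturality_apply, ha', ha']
    rw [map_d_apply] at h
    simp only [LinearMap.add_apply, LinearMap.comp_apply, LinearMap.smul_apply]
    rw [map_add, map_zsmul, eq_sub_of_add_eq h, map_d_apply, δ.d_htpy, ← h', ← ht, map_add,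
      map_zsmul, negOnePow_sub_one_smul (m - 1), smul_sub, smul_sub]
    abel
  · simp only [LinearMap.add_apply, LinearMap.comp_apply, LinearMap.smul_apply]
    rw [map_add, map_zsmul, hpk, smul_zero, add_zero, hs']

/-- A lifting problem against the morphism from the initial object is just the problem of lifting a
morphism, hence its `BarData`. -/
theorem isCofibrantObj_bar (F : Obj ⥤ D) (X : Obj ⥤ Ch.{v} K) :
    IsCofibrantObj ((bar F).obj X) := by
  rintro A B p ⟨hp, hp'⟩
  refine ⟨fun {_ s} _ => ?_⟩
  obtain ⟨δ, h₀, h₁⟩ := (BarData.ofHom s).exists_lift p hp hp'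
  refine ⟨⟨⟨δ.desc, initialIsInitial.hom_ext _ _, bar_hom_ext (fun c m x => ?_) fun f m x => ?_⟩⟩⟩
  · rw [NatTrans.comp_app, comp_apply', δ.desc_gen₀_id, ← comp_apply', h₀]
    rfl
  · rw [NatTrans.comp_app, comp_apply', δ.desc_gen₁_id, h₁]
    rfl

/-- Weak equivalences and fibrations are componentwise, so pullback preserves trivial fibrations;
transposing lifting problems gives the claim on cofibrations. -/
theorem isQuillenAdjunction_of_pullback {G : (Obj ⥤ Ch.{v} K) ⥤ (D ⥤ Ch.{v} K)}
    (a : G ⊣ pullback K F) : IsQuillenAdjunction a :=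
  ⟨fun _ _ ζ hζ _ _ p hp => (a.hasLiftingProperty_iff ζ p).2
      (hζ _ ⟨fun c => hp.1 (F.obj c), fun c => hp.2 (F.obj c)⟩),
    fun _ _ _ hζ c => hζ (F.obj c)⟩

end Model

/-! ### Bar constructions as Kan extensions -/

section Kan

variable {D : Type} [SmallCategory D] {F : Obj ⥤ D} {X : Obj ⥤ Ch.{v} K} {Y : D ⥤ Ch.{v} K}

/-- The data of a morphism from `Q(X)` to a pullback is the data of a morphism out of the bar
construction. -/
noncomputable def BarData.ofPullback (δ : BarData (𝟭 Obj) X (F ⋙ Y)) : BarData F X Y where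
  app := δ.app
  htpy := δ.htpy
  d_htpy := δ.d_htpy

/-- Existence in the universal property of `barUnit`: the generators at identities correspond,
because F(id) = id. -/
theorem barUnit_desc_ofPullback (s : (bar (𝟭 Obj)).obj X ⟶ F ⋙ Y) :
    (barUnit K F).app X ≫ (pullback K F).map (BarData.ofHom s).ofPullback.desc = s := by
  refine bar_hom_ext (F := 𝟭 Obj) (Y := F ⋙ Y) (fun c m x => ?_) fun f m x => ?_
  · refine (congr_arg (((BarData.ofHom s).ofPullback.desc.app (F.obj c)).f m).hom
      (barUnit_gen₀ (F := F) (𝟙 c) m x)).trans ?_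
    rw [F.map_id]
    exact (BarData.ofHom s).ofPullback.desc_gen₀_id c m x
  · refine (congr_arg (((BarData.ofHom s).ofPullback.desc.app (F.obj f.tgt)).f m).hom
      (barUnit_gen₁ (F := F) f (𝟙 f.tgt) m x)).trans ?_
    rw [F.map_id]
    exact (BarData.ofHom s).ofPullback.desc_gen₁_id f m x

/-- Uniqueness in the universal property of `barUnit`: its image contains the generators at
identities. -/
theorem bar_hom_ext_of_barUnit {s t : (bar F).obj X ⟶ Y}
    (h : (barUnit K F).app X ≫ (pullback K F).map s = (barUnit K F).app X ≫ (pullback K F).map t) :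
    s = t := by
  have h' (N : Obj) (m : ℤ) (x : (((bar (𝟭 Obj)).obj X).obj N).X m) :
      ((s.app (F.obj N)).f m).hom (((((barUnit K F).app X).app N).f m).hom x) =
        ((t.app (F.obj N)).f m).hom (((((barUnit K F).app X).app N).f m).hom x) :=
    congr_arg (fun k : (bar (𝟭 Obj)).obj X ⟶ F ⋙ Y => ((k.app N).f m).hom x) h
  refine bar_hom_ext (fun c m x => ?_) fun f m x => ?_
  · have h₀ := barUnit_gen₀ (F := F) (𝟙 c) m x
    rw [F.map_id] at h₀
    rw [← h₀, h']
  · have h₁ := barUnit_gen₁ (F := F) f (𝟙 f.tgt) m x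
    rw [F.map_id] at h₁
    rw [← h₁, h']

/-- The derived triangle identity: both sides send (g, x) to Y(F(g))x and kill vertical degree one.
It yields the formula for ε and later transfers weak equivalences from q and ε to η. -/
theorem barUnit_barCounit (Y : D ⥤ Ch.{v} K) :
    (barUnit K F).app (F ⋙ Y) ≫ (pullback K F).map ((barCounit K F).app Y) =
      (barCounit K (𝟭 Obj)).app (F ⋙ Y) := by
  refine NatTrans.ext (funext fun N => barObj_hom_ext (F := 𝟭 Obj)
    (fun c g m x => ?_) fun f g m x => ?_)
  · refine (congr_arg ((((barCounit K F).app Y).app (F.obj N)).f m).hom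
      (barUnit_gen₀ (F := F) g m x)).trans ?_
    refine (barCounit_gen₀ (F := F) (Y := Y) (F.map g) m x).trans ?_
    exact (barCounit_gen₀ (F := 𝟭 Obj) (Y := F ⋙ Y) g m x).symm
  · refine (congr_arg ((((barCounit K F).app Y).app (F.obj N)).f m).hom
      (barUnit_gen₁ (F := F) f g m x)).trans ?_
    refine (barCounit_gen₁ (F := F) (Y := Y) f (F.map g) m x).trans ?_
    exact (barCounit_gen₁ (F := 𝟭 Obj) (Y := F ⋙ Y) f g m x).symm

variable {G : (Obj ⥤ Ch.{v} K) ⥤ (D ⥤ Ch.{v} K)} (a : G ⊣ pullback K F)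

/-- Both `barUnit` and the adjunction unit are universal arrows from Q(X) to the pullback functor;
the inverse s is the factorization of the unit through `barUnit`. -/
theorem isIso_homEquiv_symm_barUnit (X : Obj ⥤ Ch.{v} K) :
    IsIso
      ((a.homEquiv ((bar (𝟭 Obj)).obj X) ((bar F).obj X)).symm ((barUnit K F).app X)) := by
  let s : (bar F).obj X ⟶ G.obj ((bar (𝟭 Obj)).obj X) :=
    (BarData.ofHom (Y := F ⋙ _) (a.unit.app ((bar (𝟭 Obj)).obj X))).ofPullback.desc
  have hs : (barUnit K F).app X ≫ (pullback K F).map s = a.unit.app ((bar (𝟭 Obj)).obj X) :=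
    barUnit_desc_ofPullback _
  refine ⟨s, (a.homEquiv _ _).injective ?_, bar_hom_ext_of_barUnit ?_⟩
  · rw [a.homEquiv_naturality_right, Equiv.apply_symm_apply]
    exact hs.trans (a.homEquiv_id _).symm
  · rw [Functor.map_comp]
    refine (Category.assoc _ _ _).symm.trans ((congr_arg (· ≫ _) hs).trans ?_)
    refine (a.homEquiv_unit _ _ _).symm.trans ?_
    rw [Equiv.apply_symm_apply]
    exact (Category.comp_id _).symm

/-- The bar construction is the composition of the resolution `Q` with a left adjoint of the pullback
functor. -/
noncomputable def barIso : bar F ≅ bar (𝟭 Obj) ⋙ G :=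
  (NatIso.ofComponents (fun X =>
    have := isIso_homEquiv_symm_barUnit a X
    asIso ((a.homEquiv ((bar (𝟭 Obj)).obj X) ((bar F).obj X)).symm ((barUnit K F).app X))) fun {X X'} ζ => by
      change G.map ((bar (𝟭 Obj)).map ζ) ≫ (a.homEquiv ((bar (𝟭 Obj)).obj X') ((bar F).obj X')).symm ((barUnit K F).app X') =
        (a.homEquiv ((bar (𝟭 Obj)).obj X) ((bar F).obj X)).symm ((barUnit K F).app X) ≫ (bar F).map ζ
      rw [← a.homEquiv_naturality_left_symm, ← a.homEquiv_naturality_right_symm,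
        (barUnit K F).naturality]
      rfl).symm

theorem homEquiv_symm_barUnit_barIso (X : Obj ⥤ Ch.{v} K) :
    (a.homEquiv ((bar (𝟭 Obj)).obj X) ((bar F).obj X)).symm ((barUnit K F).app X) ≫ (barIso a).hom.app X = 𝟙 _ :=
  have := isIso_homEquiv_symm_barUnit a X
  IsIso.hom_inv_id _

theorem barUnit_barIso (X : Obj ⥤ Ch.{v} K) :
    (barUnit K F).app X ≫ (pullback K F).map ((barIso a).hom.app X) = a.unit.app _ := by
  rw [← (a.homEquiv ((bar (𝟭 Obj)).obj X) ((bar F).obj X)).apply_symm_apply ((barUnit K F).app X)]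
  refine (a.homEquiv_naturality_right _ _).symm.trans ?_
  rw [homEquiv_symm_barUnit_barIso]
  exact a.homEquiv_id _

/-- It suffices to compare after `barUnit`: the left side becomes the augmentation of Q(F^*Y), and
the right side becomes the transpose of G(q) followed by the counit, which is the same augmentation.
-/
theorem barCounit_eq (Y : D ⥤ Ch.{v} K) :
    (barCounit K F).app Y = (barIso a).hom.app (F ⋙ Y) ≫
      G.map ((barCounit K (𝟭 Obj)).app (F ⋙ Y)) ≫ a.counit.app Y := by
  refine bar_hom_ext_of_barUnit ((barUnit_barCounit Y).trans ?_)
  have h₁ := a.homEquiv_naturality_left ((barCounit K (𝟭 Obj)).app (F ⋙ Y)) (a.counit.app Y)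
  have h₂ : a.homEquiv (F ⋙ Y) Y (a.counit.app Y) = 𝟙 _ :=
    (a.homEquiv_unit _ _ _).trans (a.right_triangle_components Y)
  rw [Functor.map_comp]
  refine Eq.trans ?_ (Category.assoc _ _ _)
  refine Eq.trans ?_ (congr_arg (· ≫ _) (barUnit_barIso a (F ⋙ Y)).symm)
  refine Eq.trans ?_ (a.homEquiv_unit _ _ _)
  refine Eq.trans ?_ h₁.symm
  refine Eq.trans ?_ (congr_arg (_ ≫ ·) h₂.symm)
  exact (Category.comp_id _).symm

end Kan

/-! ### Weak equivalences between bar constructions -/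

section

variable {D : Type} [SmallCategory D] {F : Obj ⥤ D} {X X' : Obj ⥤ Ch.{v} K}

/-- No cofibrancy is needed: both columns are direct sums of values of the functor. -/
theorem weakEq_bar_map (F : Obj ⥤ D) (ζ : X ⟶ X') (hζ : weakEq K Obj ζ) :
    weakEq K D ((bar F).map ζ) := fun d =>
  tot.quasiIso_map _ _ (barδ_comm (fun _ g => g) (fun _ _ => rfl) ζ)
    (dirSum.quasiIso_desc (fun i : (Σ f : Arr, F.obj f.tgt ⟶ d) => ζ.app i.1.src) fun _ => hζ _)
    (dirSum.quasiIso_desc (fun i : (Σ c : Obj, F.obj c ⟶ d) => ζ.app i.1) fun _ => hζ _)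

theorem quasiIso_barCounit_app (Y : D ⥤ Ch.{v} K) (d : D)
    (hδ : ∀ m, Function.Injective ((barδ F (F ⋙ Y) d).f m).hom)
    (hs : ∀ m, Function.Surjective
      ((desc₀ (F := F) (X := F ⋙ Y) (d := d) fun _ g => Y.map g).f m).hom)
    (he : ∀ m y, ((desc₀ (F := F) (X := F ⋙ Y) (d := d) fun _ g => Y.map g).f m).hom y = 0 →
      ∃ x, ((barδ F (F ⋙ Y) d).f m).hom x = y) :
    QuasiIso (((barCounit K F).app Y).app d) :=
  tot.quasiIso_desc _ (barδ_desc _ fun _ _ => Y.map_comp _ _) hδ hs he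

end

/-! ### The augmentation of the resolution `Q` -/

section Resolution

variable (X : Obj ⥤ Ch.{v} K)

/-- The contracting homotopy `(g, x) ↦ (id, g, x)` for `g ≠ id`, `(id, x) ↦ 0` of the resolution. -/
noncomputable def Mor.toBar₁ : {c N : Obj} → Mor c N → (X.obj c ⟶ bar₁ (𝟭 Obj) X N)
  | _, _, Mor.id _ => 0
  | _, _, Mor.iPlus => incl₁ (F := 𝟭 Obj) X Arr.iPlus (𝟙 Obj.M)
  | _, _, Mor.jPlus => incl₁ (F := 𝟭 Obj) X Arr.jPlus (𝟙 Obj.Mh)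
  | _, _, Mor.iMinus => incl₁ (F := 𝟭 Obj) X Arr.iMinus (𝟙 Obj.M)
  | _, _, Mor.jMinus => incl₁ (F := 𝟭 Obj) X Arr.jMinus (𝟙 Obj.Mh)

/-- The contracting homotopy of the resolution, from vertical degree `0` to vertical degree `1`. -/
noncomputable def resolutionHomotopy (N : Obj) : bar₀ (𝟭 Obj) X N ⟶ bar₁ (𝟭 Obj) X N :=
  desc₀ (F := 𝟭 Obj) fun _ (g : Mor _ N) => g.toBar₁ X

theorem barδ_resolutionHomotopy (N : Obj) :
    barδ (𝟭 Obj) X N ≫ resolutionHomotopy X N = 𝟙 _ := by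
  refine hom_ext₁ fun f g => ?_
  rw [barδ, incl_desc₁_assoc, Preadditive.sub_comp, Category.assoc, resolutionHomotopy, incl_desc₀,
    incl_desc₀, Category.comp_id]
  cases f
  all_goals
    revert g
    rintro (g : Mor _ N)
    -- The target of an arrow is `M` or `Mh`, whose only outgoing morphism is the identity; the
    -- homotopy vanishes on the term (id, X(f)x).
    cases g
    exact sub_eq_self.2 comp_zero

theorem resolutionHomotopy_barδ (N : Obj) :
    resolutionHomotopy X N ≫ barδ (𝟭 Obj) X N +
      desc₀ (F := 𝟭 Obj) (X := X) (d := N) (fun _ g => X.map g) ≫ incl₀ (F := 𝟭 Obj) X (𝟙 N) =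
        𝟙 _ := by
  refine hom_ext₀ fun c g => ?_
  rw [Preadditive.comp_add, resolutionHomotopy, incl_desc₀_assoc, incl_desc₀_assoc, Category.comp_id]
  have h (f : Arr) := incl_desc₁ (F := 𝟭 Obj) (d := f.tgt)
    (fun f g => incl₀ (F := 𝟭 Obj) X ((𝟭 Obj).map f.hom ≫ g) - X.map f.hom ≫ incl₀ X g) f (𝟙 f.tgt)
  revert g
  rintro (g : Mor c N)
  cases g with
  | id =>
    exact (add_eq_right.2 zero_comp).trans
      ((congr_arg (· ≫ _) (X.map_id _)).trans (Category.id_comp _))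
  | iPlus => exact eq_sub_iff_add_eq.1 (h Arr.iPlus)
  | jPlus => exact eq_sub_iff_add_eq.1 (h Arr.jPlus)
  | iMinus => exact eq_sub_iff_add_eq.1 (h Arr.iMinus)
  | jMinus => exact eq_sub_iff_add_eq.1 (h Arr.jMinus)

/-- The extra degeneracy h satisfies hδ = 1, so δ is injective. The map x ↦ (id, x) splits the
augmentation, and δh is the identity on the kernel of the augmentation. -/
theorem weakEq_q : weakEq K Obj ((q K).app X) := fun N => by
  refine quasiIso_barCounit_app (F := 𝟭 Obj) X N (fun m => ?_) (fun m y => ?_) fun m y hy => ?_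
  · refine Function.LeftInverse.injective (g := ((resolutionHomotopy X N).f m).hom) fun x => ?_
    exact congr_arg (fun k : bar₁ (𝟭 Obj) X N ⟶ bar₁ (𝟭 Obj) X N => (k.f m).hom x)
      (barδ_resolutionHomotopy X N)
  · refine ⟨((incl₀ (F := 𝟭 Obj) X (𝟙 N)).f m).hom y, ?_⟩
    refine (congr_arg (fun k : X.obj N ⟶ X.obj N => (k.f m).hom y)
      (incl_desc₀ (F := 𝟭 Obj) (X := X) (fun _ g => X.map g) (𝟙 N))).trans ?_
    rw [X.map_id]
    rfl
  · refine ⟨((resolutionHomotopy X N).f m).hom y, ?_⟩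
    have h := congr_arg (fun k : bar₀ (𝟭 Obj) X N ⟶ bar₀ (𝟭 Obj) X N => (k.f m).hom y)
      (resolutionHomotopy_barδ X N)
    refine Eq.trans ?_ h
    refine Eq.trans ?_ (congr_arg (_ + ((incl₀ (F := 𝟭 Obj) X (𝟙 N)).f m).hom ·) hy).symm
    rw [map_zero, add_zero]
    rfl

end Resolution

/-! ### The derived counit -/

section Counit

variable (Y : BZ ⥤ Ch.{v} K) (d : BZ) (m : ℤ)

/-- The position of a vertex of the line `C ×_{Bℤ} Eℤ`. -/
def Obj.position : Obj → ℤ → ℤ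
  | M, n => -4 * n
  | Mplus, n => -4 * n + 1
  | Mh, n => -4 * n + 2
  | Mminus, n => -4 * n + 3

/-- The position of the left vertex of an edge of the line `C ×_{Bℤ} Eℤ`. -/
def Arr.position : Arr → ℤ → ℤ
  | iPlus, n => -4 * n
  | jPlus, n => -4 * n + 1
  | jMinus, n => -4 * n + 2
  | iMinus, n => -4 * n - 1

/-- The orientation of an edge of the line `C ×_{Bℤ} Eℤ`. -/
def Arr.orientation : Arr → ℤ
  | iPlus => 1
  | jPlus => -1
  | jMinus => 1
  | iMinus => -1

/-- The residue modulo 4 determines the arrow, and then the quotient determines n. -/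
theorem Arr.position_injective {f f' : Arr} {n n' : ℤ} (h : f.position n = f'.position n') :
    f = f' ∧ n = n' := by
  cases f <;> cases f' <;> simp only [Arr.position] at h <;>
    first | exact ⟨rfl, by omega⟩ | (exfalso; omega)

theorem Arr.orientation_smul_orientation_smul {V : Type*} [AddCommGroup V] (f : Arr) (x : V) :
    f.orientation • f.orientation • x = x := by
  cases f <;> simp [Arr.orientation]

/-- The edge (n, f) joins two neighbouring integers, so the half-line to the right of k separates
its ends only if its left end is k; the sign is positive when the source is the right end. The slope
-4 of the positions makes `iMinus` fit: (n + 1, M₋) sits just left of (n, M). -/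
theorem Arr.ite_position_src_sub (f : Arr) (n k : ℤ) :
    (if k < f.src.position (n + Mor.level f.hom) then (1 : ℤ) else 0) -
      (if k < f.tgt.position n then 1 else 0) = if f.position n = k then f.orientation else 0 := by
  cases f <;>
    simp only [Arr.src, Arr.tgt, Arr.hom, Arr.position, Obj.position, Arr.orientation, Mor.level] <;>
    split_ifs <;> omega

/-- The integer that is given by a morphism of `Bℤ`. -/
def BZ.degree {c d : BZ} (g : c ⟶ d) : ℤ := Multiplicative.toAdd (show Multiplicative ℤ from g)

theorem BZ.degree_map_comp {c c' : Obj} (f : c ⟶ c') {d : BZ} (g : L.obj c' ⟶ d) :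
    BZ.degree (L.map f ≫ g) = BZ.degree g + Mor.level f := rfl

/-- The linear functional `(n, N, y) ↦ Y(n) y` on the vertices to the right of the position `k`. -/
noncomputable def cut (k : ℤ) : (bar₀ L (L ⋙ Y) d).X m →ₗ[K] (Y.obj d).X m :=
  descLinear₀ fun c g => (if k < c.position (BZ.degree g) then (1 : ℤ) else 0) • ((Y.map g).f m).hom

/-- The two ends of an edge have the same value under the augmentation, so in the cut functional
they cancel unless the cut goes through that edge. -/
theorem cut_barδ_incl₁ (k : ℤ) (f : Arr) (g : L.obj f.tgt ⟶ d) (y : (Y.obj (L.obj f.src)).X m) :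
    cut Y d m k (((barδ L (L ⋙ Y) d).f m).hom (((incl₁ (L ⋙ Y) f g).f m).hom y)) =
      (if f.position (BZ.degree g) = k then f.orientation else 0) •
        ((Y.map (L.map f.hom ≫ g)).f m).hom y := by
  rw [barδ_incl₁, map_sub, cut, descLinear₀_incl₀, descLinear₀_incl₀, LinearMap.smul_apply,
    LinearMap.smul_apply, ← Arr.ite_position_src_sub, sub_smul, BZ.degree_map_comp, Y.map_comp]
  rfl

theorem map_BZ_injective {c d : BZ} (g : c ⟶ d) : Function.Injective ((Y.map g).f m).hom := by
  refine Function.LeftInverse.injective (g := ((Y.map (inv g)).f m).hom) fun x => ?_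
  rw [← comp_apply', ← Y.map_comp, IsIso.hom_inv_id, Y.map_id]
  rfl

theorem map_BZ_surjective {c d : BZ} (g : c ⟶ d) : Function.Surjective ((Y.map g).f m).hom := by
  refine Function.RightInverse.surjective (g := ((Y.map (inv g)).f m).hom) fun x => ?_
  rw [← comp_apply', ← Y.map_comp, IsIso.inv_hom_id, Y.map_id]
  rfl

/-- Cutting at the edge (n, f) recovers the component of x there from δx, up to sign and an
isomorphism of Y. -/
theorem barδ_L_injective : Function.Injective ((barδ L (L ⋙ Y) d).f m).hom := by
  rw [injective_iff_map_eq_zero]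
  intro x hx
  refine dirSum.proj_ext fun i => ?_
  obtain ⟨f, g⟩ := i
  have h := LinearMap.congr_fun
    (f := f.orientation • cut Y d m (f.position (BZ.degree g)) ∘ₗ ((barδ L (L ⋙ Y) d).f m).hom)
    (g := ((Y.map (L.map f.hom ≫ g)).f m).hom ∘ₗ dirSum.proj _ ⟨f, g⟩ m)
    (bar₁_linearMap_ext fun f' g' y => by
      rw [LinearMap.smul_apply, LinearMap.comp_apply, cut_barδ_incl₁]
      by_cases h : (⟨f', g'⟩ : Σ f : Arr, L.obj f.tgt ⟶ d) = ⟨f, g⟩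
      · cases h
        rw [if_pos rfl, Arr.orientation_smul_orientation_smul]
        exact congr_arg ((Y.map (L.map f.hom ≫ g)).f m).hom
          (dirSum.proj_incl_self (Z := fun i : (Σ f : Arr, L.obj f.tgt ⟶ d) =>
          (L ⋙ Y).obj i.1.src) ⟨f, g⟩ m y).symm
      · rw [if_neg, zero_smul, smul_zero]
        · refine ((congr_arg ((Y.map (L.map f.hom ≫ g)).f m).hom
            (dirSum.proj_incl_of_ne (Z := fun i : (Σ f : Arr, L.obj f.tgt ⟶ d) =>
            (L ⋙ Y).obj i.1.src) h m y)).trans (map_zero _)).symm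
        · intro h'
          obtain ⟨rfl, h''⟩ := Arr.position_injective h'
          exact h (congr_arg (Sigma.mk f') h'')) x
  rw [LinearMap.smul_apply, LinearMap.comp_apply, hx, map_zero, smul_zero] at h
  exact (map_BZ_injective Y m (L.map f.hom ≫ g) (h.symm.trans (map_zero _).symm)).trans
    (map_zero _).symm

/-- The sum of the image of the vertical differential and of the summand of the vertex `(0, M)`. -/
noncomputable def rangeSup : Submodule K ((bar₀ L (L ⋙ Y) d).X m) :=
  LinearMap.range ((barδ L (L ⋙ Y) d).f m).hom ⊔
    LinearMap.range ((incl₀ (L ⋙ Y) (c := Obj.M) (show L.obj Obj.M ⟶ d from 𝟙 _)).f m).hom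

/-- Modulo the image of δ, the summands at the two ends of an edge are identified through the
isomorphism Y(L(f)). -/
theorem incl₀_mem_rangeSup_iff (f : Arr) (g : L.obj f.tgt ⟶ d) :
    (∀ y, ((incl₀ (L ⋙ Y) (L.map f.hom ≫ g)).f m).hom y ∈ rangeSup Y d m) ↔
      ∀ y, ((incl₀ (L ⋙ Y) g).f m).hom y ∈ rangeSup Y d m := by
  have h (y) : ((incl₀ (L ⋙ Y) (L.map f.hom ≫ g)).f m).hom y ∈ rangeSup Y d m ↔
      ((incl₀ (L ⋙ Y) g).f m).hom (((Y.map (L.map f.hom)).f m).hom y) ∈ rangeSup Y d m := by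
    have h' : ((incl₀ (L ⋙ Y) (L.map f.hom ≫ g)).f m).hom y -
        ((incl₀ (L ⋙ Y) g).f m).hom (((Y.map (L.map f.hom)).f m).hom y) ∈ rangeSup Y d m :=
      Submodule.mem_sup_left ⟨_, barδ_incl₁ (X := L ⋙ Y) f g m y⟩
    exact ⟨fun h => by simpa using sub_mem h h', fun h => by simpa using add_mem h' h⟩
  constructor
  · intro h' y
    obtain ⟨y, rfl⟩ := map_BZ_surjective Y m (L.map f.hom) y
    exact (h y).1 (h' y)
  · exact fun h' y => (h y).2 (h' _)

/-- The line is connected: every vertex is reached from (0, M) by walking along edges. -/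
theorem incl₀_mem_rangeSup (c : Obj) (g : L.obj c ⟶ d) :
    ∀ y, ((incl₀ (L ⋙ Y) g).f m).hom y ∈ rangeSup Y d m := by
  let P (c : Obj) (n : ℤ) : Prop := ∀ y, ((incl₀ (L ⋙ Y)
    (show L.obj c ⟶ d from Multiplicative.ofAdd n)).f m).hom y ∈ rangeSup Y d m
  have h (f : Arr) (n : ℤ) : P f.src (n + Mor.level f.hom) ↔ P f.tgt n :=
    incl₀_mem_rangeSup_iff Y d m f (show L.obj f.tgt ⟶ d from Multiplicative.ofAdd n)
  have h₁ (n : ℤ) : P Obj.Mplus n ↔ P Obj.M n := by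
    have := h Arr.iPlus n
    rw [show n + Mor.level Arr.iPlus.hom = n from add_zero n] at this
    exact this
  have h₂ (n : ℤ) : P Obj.Mplus n ↔ P Obj.Mh n := by
    have := h Arr.jPlus n
    rw [show n + Mor.level Arr.jPlus.hom = n from add_zero n] at this
    exact this
  have h₃ (n : ℤ) : P Obj.Mminus n ↔ P Obj.Mh n := by
    have := h Arr.jMinus n
    rw [show n + Mor.level Arr.jMinus.hom = n from add_zero n] at this
    exact this
  have h₄ (n : ℤ) : P Obj.Mminus (n + 1) ↔ P Obj.M n := h Arr.iMinus n
  have hM (n : ℤ) : P Obj.M n := by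
    -- One period of the line: M, M₊, M_h, M₋ at level n + 1, and then along `iMinus` to M at level
    -- n.
    have h₅ (n : ℤ) : P Obj.M (n + 1) ↔ P Obj.M n := by rw [← h₁, h₂, ← h₃, h₄]
    induction n using Int.induction_on with
    | zero => exact fun y => Submodule.mem_sup_right ⟨y, rfl⟩
    | succ n ih => exact (h₅ _).2 ih
    | pred n ih => exact (h₅ _).1 (by rwa [sub_add_cancel])
  have hP (n : ℤ) : P c n := by
    cases c with
    | M => exact hM n
    | Mplus => exact (h₁ n).2 (hM n)
    | Mh => exact (h₂ n).1 ((h₁ n).2 (hM n))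
    | Mminus => exact (h₃ n).2 ((h₂ n).1 ((h₁ n).2 (hM n)))
  exact hP (BZ.degree g)

theorem rangeSup_eq_top : rangeSup Y d m = ⊤ := by
  rw [← Submodule.ker_mkQ (rangeSup Y d m), LinearMap.ker_eq_top]
  refine bar₀_linearMap_ext fun c g y => ?_
  rw [LinearMap.zero_apply]
  exact (Submodule.Quotient.mk_eq_zero _).2 (incl₀_mem_rangeSup Y d m c g y)

/-- A chain of vertices is a boundary plus a chain z at (0, M). The augmentation kills the boundary
and sends the rest to z, so in its kernel z = 0. -/
theorem weakEq_ε : weakEq K BZ ((ε K).app Y) := fun d => by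
  have h₀ (m : ℤ) (y : (Y.obj d).X m) :
      ((desc₀ (F := L) (X := L ⋙ Y) (d := d) fun _ g => Y.map g).f m).hom
        (((incl₀ (L ⋙ Y) (c := Obj.M) (show L.obj Obj.M ⟶ d from 𝟙 _)).f m).hom y) = y := by
    rw [← comp_apply', incl_desc₀]
    exact congr_arg (fun k : Y.obj d ⟶ Y.obj d => (k.f m).hom y) (Y.map_id d)
  refine quasiIso_barCounit_app (F := L) Y d (barδ_L_injective Y d) (fun m y => ⟨_, h₀ m y⟩)
    fun m y hy => ?_
  obtain ⟨_, ⟨x, rfl⟩, _, ⟨z, rfl⟩, rfl⟩ := Submodule.mem_sup.1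
    (show y ∈ rangeSup Y d m from rangeSup_eq_top Y d m ▸ Submodule.mem_top)
  have hx : ((desc₀ (F := L) (X := L ⋙ Y) (d := d) fun _ g => Y.map g).f m).hom
      (((barδ L (L ⋙ Y) d).f m).hom x) = 0 :=
    congr_arg (fun k : bar₁ L (L ⋙ Y) d ⟶ Y.obj d => (k.f m).hom x)
      (barδ_desc (X := L ⋙ Y) (fun _ g => Y.map g) fun _ _ => Y.map_comp _ _)
  rw [map_add, hx, zero_add] at hy
  have hz : z = 0 := (h₀ m z).symm.trans hy
  exact ⟨x, by rw [hz, map_zero, add_zero]⟩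

end Counit

/-! ### The derived unit -/

section Unit

theorem weakEq_of_comp_left {J : Type} [SmallCategory J] {P R S : J ⥤ Ch.{v} K} {s : P ⟶ R}
    {t : R ⟶ S} (hs : weakEq K J s) (hst : weakEq K J (s ≫ t)) : weakEq K J t := fun j =>
  have := hs j
  have : QuasiIso (s.app j ≫ t.app j) := hst j
  quasiIso_of_comp_left (s.app j) (t.app j)

theorem weakEq_of_comp_right {J : Type} [SmallCategory J] {P R S : J ⥤ Ch.{v} K} {s : P ⟶ R}
    {t : R ⟶ S} (ht : weakEq K J t) (hst : weakEq K J (s ≫ t)) : weakEq K J s := fun j =>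
  have := ht j
  have : QuasiIso (s.app j ≫ t.app j) := hst j
  quasiIso_of_comp_right (s.app j) (t.app j)

theorem weakEq_comp {J : Type} [SmallCategory J] {P R S : J ⥤ Ch.{v} K} {s : P ⟶ R}
    {t : R ⟶ S} (hs : weakEq K J s) (ht : weakEq K J t) : weakEq K J (s ≫ t) := fun j =>
  have := hs j
  have := ht j
  inferInstanceAs (QuasiIso (s.app j ≫ t.app j))

theorem weakEq_pullback {P R : BZ ⥤ Ch.{v} K} {s : P ⟶ R} (hs : weakEq K BZ s) :
    weakEq K Obj ((pullback K L).map s) := fun N => hs (L.obj N)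

/-- Two-out-of-three in the triangle L^*ε ∘ η = q. -/
theorem weakEq_η_pullback (Y : BZ ⥤ Ch.{v} K) : weakEq K Obj ((η K).app (L ⋙ Y)) :=
  weakEq_of_comp_right (weakEq_pullback (weakEq_ε Y))
    (by
      have h : (η K).app (L ⋙ Y) ≫ (pullback K L).map ((ε K).app Y) = (q K).app (L ⋙ Y) :=
        barUnit_barCounit Y
      exact h ▸ weakEq_q (L ⋙ Y))

/-- Two-out-of-three in the naturality square of η, since both bar constructions preserve weak
equivalences. -/
theorem weakEq_η_iff {X X' : Obj ⥤ Ch.{v} K} (ζ : X ⟶ X') (hζ : weakEq K Obj ζ) :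
    weakEq K Obj ((η K).app X) ↔ weakEq K Obj ((η K).app X') := by
  have h₁ : weakEq K Obj ((Q K).map ζ) := weakEq_bar_map _ ζ hζ
  have h₂ : weakEq K Obj ((pullback K L).map ((LL K).map ζ)) :=
    weakEq_pullback (weakEq_bar_map _ ζ hζ)
  have h₃ : (Q K).map ζ ≫ (η K).app X' = (η K).app X ≫ (pullback K L).map ((LL K).map ζ) :=
    (η K).naturality ζ
  constructor
  · exact fun h => weakEq_of_comp_left h₁ (h₃ ▸ weakEq_comp h h₂)
  · exact fun h => weakEq_of_comp_right h₂ (h₃ ▸ weakEq_comp h₁ h)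

/-- At each N the map x ↦ (id, x) is a section of the quasi-isomorphism q. -/
theorem quasiIso_gen₀_id (X : Obj ⥤ Ch.{v} K) (N : Obj) :
    QuasiIso (gen₀ (F := 𝟭 Obj) X (𝟙 N)) := by
  have h : gen₀ (F := 𝟭 Obj) X (𝟙 N) ≫ ((q K).app X).app N = 𝟙 (X.obj N) :=
    hom_ext_apply fun m x => (barCounit_gen₀ (F := 𝟭 Obj) (Y := X) (𝟙 N) m x).trans
      (congr_arg (fun k : X.obj N ⟶ X.obj N => (k.f m).hom x) (X.map_id N))
  have : QuasiIso (gen₀ (F := 𝟭 Obj) X (𝟙 N) ≫ ((q K).app X).app N) :=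
    h.symm ▸ (inferInstance : QuasiIso (𝟙 (X.obj N)))
  exact quasiIso_of_comp_right (hφ := weakEq_q X N) (hφφ' := this)

theorem weakEq_of_quasiIso_gen₀ {X X' : Obj ⥤ Ch.{v} K} (δ : BarData (𝟭 Obj) X X')
    (h : ∀ N, QuasiIso (δ.app N)) : weakEq K Obj δ.desc := fun N => by
  have := quasiIso_gen₀_id X N
  have h' : gen₀ (F := 𝟭 Obj) X (𝟙 N) ≫ δ.desc.app N = δ.app N :=
    hom_ext_apply fun m x => δ.desc_gen₀_id N m x
  have : QuasiIso (gen₀ (F := 𝟭 Obj) X (𝟙 N) ≫ δ.desc.app N) := h' ▸ h N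
  exact quasiIso_of_comp_left (gen₀ (F := 𝟭 Obj) X (𝟙 N)) _

/-- The functor on `Bℤ` that is given by an automorphism of a complex. -/
noncomputable def ofAut {E : Ch.{v} K} (a : Aut E) : BZ ⥤ Ch.{v} K :=
  SingleObj.functor ((Aut.toEnd E).comp (zpowersHom (Aut E) a))

theorem ofAut_map_zero {E : Ch.{v} K} (a : Aut E) :
    ((ofAut a).map (X := SingleObj.star _) (Y := SingleObj.star _) (Multiplicative.ofAdd (0 : ℤ)) :
      E ⟶ E) = 𝟙 E :=
  (ofAut a).map_id (SingleObj.star _)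

theorem ofAut_map_one {E : Ch.{v} K} (a : Aut E) :
    ((ofAut a).map (X := SingleObj.star _) (Y := SingleObj.star _) (Multiplicative.ofAdd (1 : ℤ)) :
      E ⟶ E) = a.hom := by
  change (Aut.toEnd E) (zpowersHom (Aut E) a (Multiplicative.ofAdd (1 : ℤ))) = _
  rw [zpowersHom_apply, toAdd_ofAdd, zpow_one]
  rfl

variable {X : Obj ⥤ Ch.{v} K}

/-- On homology all arrows become isomorphisms, and a diagram of isomorphisms on this loop is
determined up to isomorphism by its monodromy. -/
theorem exists_iso_homology (hX : HoAll X) :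
    ∃ Y : BZ ⥤ Ch.{v} K, Nonempty (X ⋙ homologyComplex ≅ L ⋙ Y) := by
  have (f : Arr) : QuasiIso (X.map f.hom) := hX f.hom
  let i (f : Arr) := asIso (homologyComplex.map (X.map f.hom))
  -- Transport to M along the path that avoids `iMinus`. The other three arrows become identities,
  -- and `iMinus` becomes the monodromy a.
  let τ : ∀ c, homologyComplex.obj (X.obj c) ≅ homologyComplex.obj (X.obj Obj.M)
    | Obj.M => Iso.refl _
    | Obj.Mplus => i Arr.iPlus
    | Obj.Mh => (i Arr.jPlus).symm ≪≫ i Arr.iPlus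
    | Obj.Mminus => i Arr.jMinus ≪≫ (i Arr.jPlus).symm ≪≫ i Arr.iPlus
  let a : Aut (homologyComplex.obj (X.obj Obj.M)) := (τ Obj.Mminus).symm ≪≫ i Arr.iMinus
  refine ⟨ofAut a, ⟨NatIso.ofComponents τ fun {c c'} f => ?_⟩⟩
  have h (c) : (τ c).hom ≫ (ofAut a).map (X := SingleObj.star _) (Y := SingleObj.star _)
      (Multiplicative.ofAdd (0 : ℤ)) = (τ c).hom :=
    (congr_arg ((τ c).hom ≫ ·) (ofAut_map_zero a)).trans (Category.comp_id _)
  revert f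
  rintro (f : Mor c c')
  cases f with
  | id =>
    refine Eq.trans ?_ (h c).symm
    refine (congr_arg (· ≫ _) ((X ⋙ homologyComplex).map_id c)).trans ?_
    exact Category.id_comp _
  | iPlus =>
    refine Eq.trans ?_ (h Obj.Mplus).symm
    exact Category.comp_id _
  | jPlus =>
    refine Eq.trans ?_ (h Obj.Mplus).symm
    exact (i Arr.jPlus).hom_inv_id_assoc (i Arr.iPlus).hom
  | iMinus =>
    refine Eq.trans ?_ (congr_arg ((τ Obj.Mminus).hom ≫ ·) (ofAut_map_one a)).symm
    exact (Category.comp_id _).trans ((τ Obj.Mminus).hom_inv_id_assoc (i Arr.iMinus).hom).symm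
  | jMinus =>
    exact (h Obj.Mminus).symm

variable (X) in
-- The naturality defect of `toHomology` vanishes on cycles, so over a field it factors through the
-- differential, and the factor is the required homotopy. As the target has zero differential,
-- nothing else has to be checked.
theorem exists_barData_homology : ∃ δ : BarData (𝟭 Obj) X (X ⋙ homologyComplex),
    ∀ c, δ.app c = toHomology (X.obj c) := by
  have h (f : Arr) (m : ℤ) := exists_comp_eq_of_ker_le ((X.obj f.src).d m (m - 1)).hom
    ((m.negOnePow : ℤ) • (((toHomology (X.obj f.tgt)).f m).hom ∘ₗ ((X.map f.hom).f m).hom -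
      ((homologyComplex.map (X.map f.hom)).f m).hom ∘ₗ ((toHomology (X.obj f.src)).f m).hom))
    fun x hx => by
      simp only [LinearMap.smul_apply, LinearMap.sub_apply, LinearMap.comp_apply]
      rw [homologyMap_toHomology _ hx, sub_self, smul_zero]
  choose k hk using h
  refine ⟨{
    app := fun c => toHomology (X.obj c)
    htpy := k
    d_htpy := fun f m x => ?_ }, fun c => rfl⟩
  have h₀ {V : ModuleCat.{v} K} (n : ℤ) (a b : V) : 0 = n • (a - b) + n • (b - a) := by
    rw [← smul_add, sub_add_sub_cancel, sub_self, smul_zero]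
  rw [hk f (m - 1)]
  exact h₀ _ _ _

/-- The comparison of X with its homology is natural only up to homotopy, so it becomes a strict
morphism only after X is replaced by Q(X). This gives the zigzag X ← Q(X) → H(X) ≅ L^*Y of weak
equivalences. -/
theorem weakEq_η (hX : HoAll X) : weakEq K Obj ((η K).app X) := by
  obtain ⟨Y, ⟨e⟩⟩ := exists_iso_homology hX
  obtain ⟨δ, hδ⟩ := exists_barData_homology X
  have he : weakEq K Obj e.hom := fun N =>
    have : IsIso (e.hom.app N) := inferInstance
    inferInstance
  have h : weakEq K Obj δ.desc := weakEq_of_quasiIso_gen₀ δ fun N =>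
    hδ N ▸ (inferInstance : QuasiIso (toHomology (X.obj N)))
  refine (weakEq_η_iff (X := (Q K).obj X) (X' := X) ((q K).app X) (weakEq_q X)).1 ?_
  exact (weakEq_η_iff δ.desc h).2 ((weakEq_η_iff e.hom he).2 (weakEq_η_pullback Y))

end Unit

end RCE

theorem theorem4p2 (K : Type u) [Field K] :
    -- `L_! ⊣ L^*` is a Quillen adjunction for the projective model structures
    RCE.IsQuillenAdjunction (RCE.adj.{v} K) ∧
    -- `q : Q ⟶ id` is a functorial cofibrant replacement
    (∀ X : RCE.Obj ⥤ RCE.Ch.{v} K,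
      RCE.IsCofibrantObj ((RCE.Q K).obj X) ∧ RCE.weakEq K RCE.Obj ((RCE.q K).app X)) ∧
    -- the bar models are the left derived functor `L_! Q`, the derived unit `Q ⟶ L^* L_! Q` and the
    -- derived counit `L_! Q L^* ⟶ L_! L^* ⟶ id`
    (∃ θ : RCE.LL.{v} K ≅ RCE.Q K ⋙ RCE.Lan K,
      (∀ X : RCE.Obj ⥤ RCE.Ch.{v} K,
        (RCE.η K).app X ≫ (RCE.pullback K RCE.L).map (θ.hom.app X) =
          (RCE.adj K).unit.app ((RCE.Q K).obj X)) ∧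
      (∀ Y : RCE.BZ ⥤ RCE.Ch.{v} K,
        (RCE.ε K).app Y =
          θ.hom.app ((RCE.pullback K RCE.L).obj Y) ≫
            (RCE.Lan K).map ((RCE.q K).app ((RCE.pullback K RCE.L).obj Y)) ≫
              (RCE.adj K).counit.app Y)) ∧
    -- the derived counit is a natural weak equivalence
    (∀ Y : RCE.BZ ⥤ RCE.Ch.{v} K, RCE.weakEq K RCE.BZ ((RCE.ε K).app Y)) ∧
    -- the derived unit is a natural weak equivalence on functors inverting all morphisms up to homotopy
    (∀ X : RCE.Obj ⥤ RCE.Ch.{v} K, RCE.HoAll X → RCE.weakEq K RCE.Obj ((RCE.η K).app X)) :=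
  ⟨RCE.isQuillenAdjunction_of_pullback _,
    fun X => ⟨RCE.isCofibrantObj_bar _ X, RCE.weakEq_q X⟩,
    ⟨RCE.barIso (RCE.adj K), fun X => RCE.barUnit_barIso (RCE.adj K) X,
      fun Y => RCE.barCounit_eq (RCE.adj K) Y⟩,
    fun Y => RCE.weakEq_ε Y, fun _ hX => RCE.weakEq_η hX⟩
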